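/- **Theorem 1.2 (Theorem1L).** For $w\in\mathbb C$ let $Q_L(w)=\dfrac{\sqrt w}{\tanh\sqrt w}$ (with $Q_L(0)=1$), the characteristic series of Hirzebruch's $L$-genus, regarded as a meromorphic function of $w$ (its poles are the points $(k\pi i)^2$, $k\in\mathbb Z\setminus\{0\}$). For $\tau\in\mathbb C$ with $\operatorname{Im}\tau>0$ and real $s>0$ put $$X_\tau(s)=\left\{\frac{1}{(m\tau+n)^2\,|m\tau+n|^{s}} : m,n\in\mathbb Z,\ \gcd(m,n)=1\right\},\qquad L(X_\tau(s);t)=\prod_{x\in X_\tau(s)}Q_L(xt),$$ where $X_\tau(s)$ is a set, so that $(m,n)$ and $(-m,-n)$ give the same element. Let $u=e^{2\pi i z}$, $q=e^{2\pi i\tau}$ (with $u^{1/2}=e^{\pi i z}$, $q^{a}=e^{2\pi i a\tau}$), $\theta(z;\tau)=\sum_{n\in\mathbb Z}u^nq^{n^2/2}$, $\eta(\tau)=q^{1/24}\prod_{n\ge1}(1-q^n)$ and $$\widetilde\Theta(z;\tau)=\exp\left(\frac{\pi}{2}\cdot\frac{z^2}{\operatorname{Im}\tau}\right)u^{1/2}q^{1/8}\,\frac{\theta\left(z+\frac\tau2+\frac12;\tau\right)}{\eta(\tau)^3}.$$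 Fix $\tau$ with $\operatorname{Im}\tau>0$. 1. For all $z\in\mathbb C$ and $s>0$ such that no factor of $L(X_\tau(s);(\pi i z)^2)$ has a pole, this product converges unconditionally. 2. For every $z\in\mathbb C\setminus(\mathbb Z\tau+\mathbb Z)$, no factor has a pole once $s>0$ is sufficiently small, $\widetilde\Theta(z;\tau)\neq0$, and $$\lim_{s\to0^+}L\left(X_\tau(s);(\pi i z)^2\right)=\pi i z\cdot\frac{\widetilde\Theta(2z;\tau)}{\widetilde\Theta(z;\tau)^2}.$$ 3. The identity also holds at $z=0$, where the right-hand side has a removable singularity: both the limit on the left at $z=0$ and the limit of the right-hand side as $z\to0$, $z\ne0$, are equal to $1$. -/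

import Mathlib

open Filter Topology

noncomputable section

/-- The characteristic series `Q_L(w) = √w / tanh √w` of Hirzebruch's `L`-genus, as a meromorphic
function of `w` with `Q_L(0) = 1`. Since `y / tanh y` is even, the choice of the square root is
immaterial. The poles of `Q_L` are the points `(k π i)²` with `k ≠ 0` an integer. -/
def QL (w : ℂ) : ℂ :=
  if w = 0 then 1 else Complex.sqrt w / Complex.tanh (Complex.sqrt w)

/-- The set of poles of `Q_L`. -/
def QLPoles : Set ℂ :=
  {w | ∃ k : ℤ, k ≠ 0 ∧ w = ((k : ℂ) * Real.pi * Complex.I) ^ 2}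

/-- The set `X_τ(s)` of all numbers `1 / ((mτ + n)² |mτ + n|ˢ)` with `m, n` coprime integers. As it
is a set, `(m, n)` and `(-m, -n)` contribute a single element. -/
def Xset (τ : ℂ) (s : ℝ) : Set ℂ :=
  {x | ∃ m n : ℤ, Int.gcd m n = 1 ∧
    x = 1 / (((m : ℂ) * τ + n) ^ 2 * ((‖(m : ℂ) * τ + n‖ ^ s : ℝ) : ℂ))}

/-- The product `L(X; t) = ∏_{x ∈ X} Q_L(x t)`. -/
def LGenus (X : Set ℂ) (t : ℂ) : ℂ := ∏' x : X, QL ((x : ℂ) * t)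

/-- The modified theta function `Θ̃(z; τ) =
exp((π/2) z² / Im τ) · u^{1/2} q^{1/8} · θ(z + τ/2 + 1/2; τ) / η(τ)³`, where `u = e^{2πiz}`,
`q = e^{2πiτ}`, `u^{1/2} = e^{πiz}`, `q^{1/8} = e^{2πiτ/8}`, and `θ(z; τ) = ∑_{n ∈ ℤ} uⁿ q^{n²/2}`,
which is Mathlib's `jacobiTheta₂`. -/
def thetaTilde (z τ : ℂ) : ℂ :=
  Complex.exp ((Real.pi : ℂ) / 2 * (z ^ 2 / (τ.im : ℂ)))
    * (Complex.exp (Real.pi * Complex.I * z) * Complex.exp (2 * Real.pi * Complex.I * τ / 8))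
    * (jacobiTheta₂ (z + τ / 2 + 1 / 2) τ / ModularForm.eta τ ^ 3)

end

/-! ### The characteristic series: expansion at the origin, poles, continuity. -/

section CharacteristicSeries

open Complex Asymptotics
open scoped Real

/-! Modulo sign, the primitive lattice points are `1` and the `ω = mτ + n` with `m ≥ 1`, so the
genus is `QL t`, with `t = (πiz)²`, times a product over the latter. Since `QL w = 1 + w/3 + O(w²)`,
that product equals `exp (t/3 · ∑ ω⁻²|ω|⁻ˢ)` times a product of normalized factors `1 + O(ω⁻⁴)`. The
normalized product converges uniformly down to `s = 0` (`exists_normalizedFactor_bound`); only the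
exponential feels the conditional convergence.

Hecke's trick (`tendsto_tsum_heckeTerm`) handles the exponential. Compare each row of the lattice
sum with an integral: the errors are `O(|ω|⁻³)`, hence continuous at `s = 0` with sum `G`,
Eisenstein's iterated sum over `m ≥ 1`. The integrals contribute a quantity of order `s` times
`ζ(1+s)`, with limit `-π/(2 Im τ)`. Grouping multiples of primitive points divides the full sum by
`ζ(2+s)`.

At `s = 0` the formula `sin 2x = 2 sin x cos x` says that `sinc(2y) = sinc(y)² QL((πiy)²)`. By
Euler's sine product, the product of `sinc(z/ω)` with convergence factors over primitive `ω` is the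
Weierstrass product over all `ω` with `m ≥ 1`; by rows this is `thetaProd z τ · exp (z² G)`
(`hasProd_weierstrass`). Doubling `z` therefore evaluates the normalized product
(`weierstrass_two_mul`).

The Jacobi triple product identifies `thetaTilde` with a Gaussian factor times `2i sin πz` times
`thetaProd` (`thetaTilde_eq`). In the final comparison all powers of `exp (z² G)` cancel, the sines
account for `QL t`, and Hecke's correction gives exactly the Gaussian ratio `exp (πz²/Im τ)`. -/

lemma Complex.sqrt_sq_eq (w : ℂ) : Complex.sqrt w ^ 2 = w := by
  rw [Complex.sqrt, ← Complex.cpow_nat_mul]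
  simp

lemma QL_sq {y : ℂ} (hy : y ≠ 0) : QL (y ^ 2) = y / tanh y := by
  have h0 : y ^ 2 ≠ 0 := pow_ne_zero 2 hy
  rw [QL, if_neg h0]
  rcases sq_eq_sq_iff_eq_or_eq_neg.mp (Complex.sqrt_sq_eq (y ^ 2)) with h | h
  · rw [h]
  · rw [h, tanh_neg, neg_div_neg_eq]

lemma QL_sq_mul_sinh {y : ℂ} (hy : sinh y ≠ 0) : QL (y ^ 2) * sinh y = y * cosh y := by
  have h0 : y ≠ 0 := by rintro rfl; simp at hy
  rw [QL_sq h0, tanh_eq_sinh_div_cosh]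
  field_simp

lemma norm_sinh_sub_le {y : ℂ} (hy : ‖y‖ ≤ 1) : ‖sinh y - (y + y ^ 3 / 6)‖ ≤ ‖y‖ ^ 5 := by
  have h1 := Complex.exp_bound hy (n := 5) (by norm_num)
  have h2 := Complex.exp_bound (x := -y) (by simpa using hy) (n := 5) (by norm_num)
  have e : sinh y - (y + y ^ 3 / 6)
      = ((exp y - ∑ m ∈ Finset.range 5, y ^ m / m.factorial)
        - (exp (-y) - ∑ m ∈ Finset.range 5, (-y) ^ m / m.factorial)) / 2 := by
    simp only [sinh, Finset.sum_range_succ, Nat.factorial]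
    push_cast
    simp only [Finset.range_zero, Finset.sum_empty]
    ring
  rw [e, norm_div, Complex.norm_two]
  have h3 := norm_sub_le (exp y - ∑ m ∈ Finset.range 5, y ^ m / m.factorial)
    (exp (-y) - ∑ m ∈ Finset.range 5, (-y) ^ m / m.factorial)
  rw [norm_neg] at h2
  norm_num [Nat.factorial] at h1 h2
  have : 0 ≤ ‖y‖ ^ 5 := by positivity
  linarith

lemma norm_cosh_sub_le {y : ℂ} (hy : ‖y‖ ≤ 1) : ‖cosh y - (1 + y ^ 2 / 2)‖ ≤ ‖y‖ ^ 4 := by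
  have h1 := Complex.exp_bound hy (n := 4) (by norm_num)
  have h2 := Complex.exp_bound (x := -y) (by simpa using hy) (n := 4) (by norm_num)
  have e : cosh y - (1 + y ^ 2 / 2)
      = ((exp y - ∑ m ∈ Finset.range 4, y ^ m / m.factorial)
        + (exp (-y) - ∑ m ∈ Finset.range 4, (-y) ^ m / m.factorial)) / 2 := by
    simp only [cosh, Finset.sum_range_succ, Nat.factorial]
    push_cast
    simp only [Finset.range_zero, Finset.sum_empty]
    ring
  rw [e, norm_div, Complex.norm_two]
  have h3 := norm_add_le (exp y - ∑ m ∈ Finset.range 4, y ^ m / m.factorial)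
    (exp (-y) - ∑ m ∈ Finset.range 4, (-y) ^ m / m.factorial)
  rw [norm_neg] at h2
  norm_num [Nat.factorial] at h1 h2
  have : 0 ≤ ‖y‖ ^ 4 := by positivity
  linarith

lemma norm_exp_sub_one_sub_le {w : ℂ} (hw : ‖w‖ ≤ 1) : ‖exp w - (1 + w)‖ ≤ ‖w‖ ^ 2 := by
  simpa [sub_sub] using Complex.norm_exp_sub_one_sub_id_le hw

/-- The exponential cancels the linear term of `QL w = 1 + w/3 + O(w²)`. An explicit constant on an
explicit disc gives a bound uniform in `s` and in the lattice point. -/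
lemma norm_QL_mul_exp_sub_one_le {w : ℂ} (hw : ‖w‖ ≤ 1 / 4) :
    ‖QL w * exp (-w / 3) - 1‖ ≤ 14 * ‖w‖ ^ 2 := by
  rcases eq_or_ne w 0 with rfl | h0
  · simp [QL]
  obtain ⟨y, rfl⟩ : ∃ y, y ^ 2 = w := ⟨_, Complex.sqrt_sq_eq w⟩
  have hy0 : y ≠ 0 := by rintro rfl; simp at h0
  have hy : ‖y‖ ≤ 1 / 2 := by
    rw [norm_pow] at hw
    nlinarith [norm_nonneg y]
  have hpos : 0 < ‖y‖ := norm_pos_iff.mpr hy0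
  have hS := norm_sinh_sub_le (y := y) (by linarith)
  have hC := norm_cosh_sub_le (y := y) (by linarith)
  have hE := norm_exp_sub_one_sub_le (w := -y ^ 2 / 3) (by
    rw [norm_div, norm_neg]; norm_num; rw [norm_pow] at hw; norm_num at hw; nlinarith)
  set e1 := sinh y - (y + y ^ 3 / 6) with he1
  set e2 := cosh y - (1 + y ^ 2 / 2) with he2
  set e3 := exp (-y ^ 2 / 3) - (1 + -y ^ 2 / 3) with he3
  have hE' : ‖e3‖ ≤ ‖y‖ ^ 4 := by
    refine hE.trans ?_
    rw [norm_div, norm_neg, norm_pow]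
    norm_num
    nlinarith [pow_nonneg (norm_nonneg y) 4]
  have p2 : ‖y‖ ^ 2 ≤ 1 / 4 := by nlinarith
  have p4 : ‖y‖ ^ 4 ≤ 1 / 16 := by nlinarith [sq_nonneg (‖y‖), pow_nonneg (norm_nonneg y) 4]
  have hsinh : ‖y‖ / 2 ≤ ‖sinh y‖ := by
    have e : y = sinh y - y ^ 3 / 6 - e1 := by rw [he1]; ring
    have h1 : ‖y‖ ≤ ‖sinh y‖ + ‖y‖ ^ 3 / 6 + ‖y‖ ^ 5 := by
      calc ‖y‖ = ‖sinh y - y ^ 3 / 6 - e1‖ := by rw [← e]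
        _ ≤ ‖sinh y‖ + ‖y ^ 3 / 6‖ + ‖e1‖ := (norm_sub_le _ _).trans (by gcongr; exact norm_sub_le _ _)
        _ ≤ _ := by gcongr; simp
    have h3 : ‖y‖ ^ 3 ≤ ‖y‖ * (1 / 4) := by
      rw [pow_succ' ‖y‖ 2]; gcongr
    have h5 : ‖y‖ ^ 5 ≤ ‖y‖ * (1 / 16) := by
      rw [pow_succ' ‖y‖ 4]; gcongr
    linarith
  have hs0 : sinh y ≠ 0 := by
    rw [← norm_pos_iff]; linarith
  -- Multiplying by `sinh y` clears the denominator. The terms of degree 1 and 3 of `y cosh y · exp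
  -- (-y²/3) - sinh y` cancel, so everything left is of order `y⁵`.
  have key : (QL (y ^ 2) * exp (-y ^ 2 / 3) - 1) * sinh y
      = y * (-(y ^ 4) / 6 + (1 + y ^ 2 / 2) * e3 + e2 * (1 - y ^ 2 / 3 + e3)) - e1 := by
    have h : (QL (y ^ 2) * exp (-y ^ 2 / 3) - 1) * sinh y
        = (QL (y ^ 2) * sinh y) * exp (-y ^ 2 / 3) - sinh y := by ring
    rw [h, QL_sq_mul_sinh hs0, he1, he2, he3]
    ring
  have hb : ‖(QL (y ^ 2) * exp (-y ^ 2 / 3) - 1) * sinh y‖ ≤ 7 * ‖y‖ ^ 5 := by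
    rw [key]
    have n1 : ‖1 + y ^ 2 / 2‖ ≤ 2 := by
      refine (norm_add_le _ _).trans ?_
      rw [norm_div, norm_pow]; norm_num; linarith
    have n2 : ‖1 - y ^ 2 / 3 + e3‖ ≤ 3 := by
      refine (norm_add_le _ _).trans ?_
      have := norm_sub_le (1 : ℂ) (y ^ 2 / 3)
      rw [norm_div, norm_pow] at this
      norm_num at this
      linarith
    calc _ ≤ ‖y‖ * (‖y‖ ^ 4 / 6 + 2 * ‖y‖ ^ 4 + ‖y‖ ^ 4 * 3) + ‖y‖ ^ 5 := by
          refine (norm_sub_le _ _).trans (add_le_add ?_ hS)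
          rw [norm_mul]
          gcongr
          refine (norm_add_le _ _).trans (add_le_add ((norm_add_le _ _).trans
            (add_le_add ?_ ?_)) ?_)
          · simp
          · rw [norm_mul]; gcongr
          · rw [norm_mul]; gcongr
      _ ≤ _ := by
        have : 0 ≤ ‖y‖ ^ 5 := by positivity
        nlinarith
  rw [norm_mul] at hb
  have h5 : ‖QL (y ^ 2) * exp (-y ^ 2 / 3) - 1‖ * (‖y‖ / 2) ≤ 7 * ‖y‖ ^ 5 :=
    (mul_le_mul_of_nonneg_left hsinh (norm_nonneg _)).trans hb
  have h6 : ‖QL (y ^ 2) * exp (-y ^ 2 / 3) - 1‖ * ‖y‖ ≤ (14 * ‖y‖ ^ 4) * ‖y‖ := by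
    linarith [show (14 * ‖y‖ ^ 4) * ‖y‖ = 2 * (7 * ‖y‖ ^ 5) by ring]
  have h7 := le_of_mul_le_mul_right h6 hpos
  rw [norm_pow]
  calc _ ≤ _ := h7
    _ = _ := by ring

lemma QL_sub_one_isBigO : (fun w ↦ QL w - 1) =O[𝓝 0] (fun w : ℂ ↦ w) := by
  have h1 : (fun w ↦ QL w * exp (-w / 3) - 1) =O[𝓝 0] (fun w : ℂ ↦ w) := by
    have : (fun w ↦ QL w * exp (-w / 3) - 1) =O[𝓝 0] (fun w : ℂ ↦ w ^ 2) := by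
      refine IsBigO.of_bound 14 ?_
      filter_upwards [Metric.closedBall_mem_nhds (0 : ℂ) (by norm_num : (0 : ℝ) < 1 / 4)] with w hw
      rw [norm_pow]
      exact norm_QL_mul_exp_sub_one_le (by simpa using hw)
    refine this.trans ?_
    have := (isBigO_refl (fun w : ℂ ↦ w) (𝓝 0)).mul
      ((continuous_id.tendsto (0 : ℂ)).isBigO_one ℂ)
    simpa [sq] using this
  have h2 : (fun w : ℂ ↦ exp (w / 3)) =O[𝓝 0] (fun _ ↦ (1 : ℂ)) :=
    (Continuous.tendsto (f := fun w : ℂ ↦ exp (w / 3)) (by fun_prop) 0).isBigO_one ℂ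
  have h3 : (fun w : ℂ ↦ exp (w / 3) - 1) =O[𝓝 0] (fun w : ℂ ↦ w) := by
    have : HasDerivAt (fun w : ℂ ↦ exp (w / 3)) (exp (0 / 3) * (1 / 3)) 0 :=
      ((hasDerivAt_id (0 : ℂ)).div_const 3).cexp
    simpa using this.isBigO_sub
  have h4 := (h1.mul h2).add (h3.trans (by simpa using isBigO_refl (fun w : ℂ ↦ w) (𝓝 0)) :
    (fun w : ℂ ↦ exp (w / 3) - 1) =O[𝓝 0] (fun w : ℂ ↦ w * 1))
  refine (h4.congr (fun w ↦ ?_) (fun w ↦ mul_one w))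
  have : exp (-w / 3) * exp (w / 3) = 1 := by rw [← exp_add]; ring_nf; simp
  linear_combination QL w * this

lemma sinh_eq_zero_of_mem_QLPoles {w : ℂ} (hw : w ∈ QLPoles) {y : ℂ} (hy : y ^ 2 = w) :
    sinh y = 0 := by
  obtain ⟨k, -, hk⟩ := hw
  rw [hk] at hy
  have h : sinh ((k : ℂ) * Real.pi * I) = 0 := by
    rw [sinh_mul_I, Complex.sin_int_mul_pi, zero_mul]
  rcases sq_eq_sq_iff_eq_or_eq_neg.mp hy with h1 | h1
  · rw [h1, h]
  · rw [h1, sinh_neg, h, neg_zero]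

lemma sinh_ne_zero_of_notMem_QLPoles {y : ℂ} (hy : y ≠ 0) (h : y ^ 2 ∉ QLPoles) :
    sinh y ≠ 0 := by
  intro h0
  have h1 : Complex.sin (y * I) = 0 := by rw [sin_mul_I, h0, zero_mul]
  obtain ⟨k, hk⟩ := Complex.sin_eq_zero_iff.mp h1
  have hk2 : y = -((k : ℂ) * π * I) := by
    have : y * I * I = k * π * I := by rw [hk]
    linear_combination -this - (-1 : ℂ) * y * I_sq
  refine h ⟨k, ?_, by rw [hk2]; ring⟩
  rintro rfl
  simp at hk2
  exact hy hk2

/-- Follows from `π > 3`; it keeps the factors of distant lattice points away from the poles. -/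
lemma nine_le_norm_of_mem_QLPoles {w : ℂ} (hw : w ∈ QLPoles) : 9 ≤ ‖w‖ := by
  obtain ⟨k, hk, rfl⟩ := hw
  have h1 : (1 : ℝ) ≤ |(k : ℝ)| := by exact_mod_cast Int.one_le_abs hk
  have h2 := Real.pi_gt_three
  rw [norm_pow, norm_mul, norm_mul, norm_I, mul_one, Complex.norm_intCast, Complex.norm_real,
    Real.norm_of_nonneg Real.pi_pos.le]
  nlinarith [mul_le_mul h1 h2.le (by norm_num) (by positivity)]

/-- Near a nonzero point that is not a pole, `Q_L` is given by a continuous branch of the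
square root. -/
lemma exists_sqrt_branch {w₀ : ℂ} (h0 : w₀ ≠ 0) :
    ∃ r : ℂ → ℂ, ContinuousAt r w₀ ∧ ∀ w, r w ^ 2 = w := by
  -- Dividing by `w₀` moves the base point to `1`, away from the branch cut of the principal root.
  refine ⟨fun w ↦ Complex.sqrt w₀ * Complex.sqrt (w / w₀), ?_, fun w ↦ ?_⟩
  · refine continuousAt_const.mul ?_
    refine ContinuousAt.comp (f := fun w ↦ w / w₀) (g := Complex.sqrt) ?_ (by fun_prop)
    rw [div_self h0]
    unfold Complex.sqrt
    exact continuousAt_id.cpow continuousAt_const (by simp)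
  · rw [mul_pow, Complex.sqrt_sq_eq, Complex.sqrt_sq_eq, mul_div_cancel₀ _ h0]

lemma eventually_notMem_QLPoles {w₀ : ℂ} (h : w₀ ∉ QLPoles) : ∀ᶠ w in 𝓝 w₀, w ∉ QLPoles := by
  rcases eq_or_ne w₀ 0 with rfl | h0
  · filter_upwards [Metric.ball_mem_nhds (0 : ℂ) one_pos] with w hw hp
    have := nine_le_norm_of_mem_QLPoles hp
    simp at hw
    linarith
  · obtain ⟨r, hr, hr2⟩ := exists_sqrt_branch h0
    have hr0 : r w₀ ≠ 0 := by
      intro h'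
      have := hr2 w₀
      rw [h'] at this
      exact h0 (by simpa using this.symm)
    have hs := sinh_ne_zero_of_notMem_QLPoles hr0 (by rwa [hr2])
    have hc : ContinuousAt (fun w ↦ sinh (r w)) w₀ :=
      Complex.continuous_sinh.continuousAt.comp hr
    filter_upwards [hc.eventually_ne hs] with w hw hp
    exact hw (sinh_eq_zero_of_mem_QLPoles hp (hr2 w))

lemma continuousAt_QL {w₀ : ℂ} (h : w₀ ∉ QLPoles) : ContinuousAt QL w₀ := by
  rcases eq_or_ne w₀ 0 with rfl | h0
  · have h1 := QL_sub_one_isBigO.trans_tendsto (continuous_id.tendsto (0 : ℂ))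
    have h2 := h1.add_const 1
    simp only [sub_add_cancel, zero_add] at h2
    rw [ContinuousAt, show QL 0 = 1 by simp [QL]]
    exact h2
  · obtain ⟨r, hr, hr2⟩ := exists_sqrt_branch h0
    have hr0 : r w₀ ≠ 0 := by
      intro h'
      have := hr2 w₀
      rw [h'] at this
      exact h0 (by simpa using this.symm)
    have hs := sinh_ne_zero_of_notMem_QLPoles hr0 (by rwa [hr2])
    have hc : ContinuousAt (fun w ↦ r w * cosh (r w) / sinh (r w)) w₀ :=
      (hr.mul (Complex.continuous_cosh.continuousAt.comp hr)).div
        (Complex.continuous_sinh.continuousAt.comp hr) hs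
    refine hc.congr ?_
    have hc' : ContinuousAt (fun w ↦ sinh (r w)) w₀ :=
      Complex.continuous_sinh.continuousAt.comp hr
    filter_upwards [hc'.eventually_ne hs] with w hw
    rw [div_eq_iff hw, ← QL_sq_mul_sinh hw, hr2]

end CharacteristicSeries

/-! ### Euler's sine product and its version over a translate of the integers. -/

section SineProduct

open Complex
open scoped Real

/-- The normalized sine `sin (π x) / (π x)`, continued by `1` at `x = 0`. -/
noncomputable def sincPi (x : ℂ) : ℂ := if x = 0 then 1 else sin (π * x) / (π * x)

lemma mul_sincPi (x : ℂ) : π * x * sincPi x = sin (π * x) := by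
  unfold sincPi
  split_ifs with h
  · simp [h]
  · have : (π : ℂ) ≠ 0 := by exact_mod_cast Real.pi_ne_zero
    field_simp

lemma hasProd_sincPi (x : ℂ) :
    HasProd (fun n : ℕ ↦ 1 - x ^ 2 / ((n : ℂ) + 1) ^ 2) (sincPi x) := by
  have e : (fun n : ℕ ↦ 1 - x ^ 2 / ((n : ℂ) + 1) ^ 2) = fun n ↦ 1 + sineTerm x n := by
    funext n
    simp only [sineTerm]
    ring
  rw [e]
  unfold sincPi
  split_ifs with h
  · subst h
    simp only [sineTerm]
    simp
  · rw [Multipliable.hasProd_iff_tendsto_nat (multipliable_sineTerm x)]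
    exact tendsto_euler_sin_prod' h

lemma sin_pi_mul_ne_zero_of_add_int_ne_zero {w : ℂ} (hw : ∀ n : ℤ, w + n ≠ 0) :
    sin (π * w) ≠ 0 := by
  intro h
  obtain ⟨k, hk⟩ := Complex.sin_eq_zero_iff.mp h
  have hpi : (π : ℂ) ≠ 0 := by exact_mod_cast Real.pi_ne_zero
  have : w = k := mul_left_cancel₀ hpi (by rw [hk, mul_comm])
  exact hw (-k) (by rw [this]; push_cast; ring)

/-- Pairing `n` with `-n` turns the factors into quotients `(1 - (w+z)²/n²)(1 - (w-z)²/n²) / (1 -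
w²/n²)²`, so three Euler products determine the value. -/
lemma hasProd_one_sub_sq_div_add_int_sq {w : ℂ} (hw : ∀ n : ℤ, w + n ≠ 0) (z : ℂ) :
    HasProd (fun n : ℤ ↦ 1 - z ^ 2 / (w + n) ^ 2)
      (sin (π * (w + z)) * sin (π * (w - z)) / sin (π * w) ^ 2) := by
  set f : ℤ → ℂ := fun n ↦ 1 - z ^ 2 / (w + n) ^ 2 with hf
  have hsw := sin_pi_mul_ne_zero_of_add_int_ne_zero hw
  have hw0 : w ≠ 0 := by simpa using hw 0
  have hpi : (π : ℂ) ≠ 0 := by exact_mod_cast Real.pi_ne_zero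
  have hsum : Summable fun n : ℤ ↦ ((w + n) ^ 2)⁻¹ := by
    simpa [zpow_ofNat] using EisensteinSeries.linear_right_summable w 1 (k := 2) le_rfl
  have hm : Multipliable f := by
    have : f = fun n : ℤ ↦ 1 + -(z ^ 2 * ((w + n) ^ 2)⁻¹) := by
      funext n; simp only [hf]; ring
    rw [this]
    exact multipliable_one_add_of_summable (hsum.mul_left (z ^ 2)).neg.norm
  -- The pairing counts the index `0` twice, so `f 0` has to be cancelled later; if it vanishes, the
  -- whole product is zero.
  by_cases h0 : f 0 = 0
  · have h1 : HasProd f 0 := hasProd_zero_of_exists_eq_zero ⟨0, h0⟩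
    convert h1 using 1
    have h2 : (w + z) * (w - z) = 0 := by
      simp only [hf, Int.cast_zero, add_zero] at h0
      field_simp at h0
      linear_combination h0
    rcases mul_eq_zero.mp h2 with h | h <;> simp [h]
  · have h1 := hm.hasProd
    have h2 := h1.nat_mul_neg
    have h3 := ((hasProd_sincPi w).mul (hasProd_sincPi w))
    have h3' := HasProd.zero_mul (f := fun n : ℕ ↦ if n = 0 then (1 : ℂ) else
      (1 - w ^ 2 / (n : ℂ) ^ 2) * (1 - w ^ 2 / (n : ℂ) ^ 2)) (by simpa using h3)
    have h4 := (hasProd_sincPi (w + z)).mul (hasProd_sincPi (w - z))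
    have h4' := HasProd.zero_mul (f := fun n : ℕ ↦ if n = 0 then f 0 * f 0 else
      (1 - (w + z) ^ 2 / (n : ℂ) ^ 2) * (1 - (w - z) ^ 2 / (n : ℂ) ^ 2)) (by simpa using h4)
    have h5 := h2.mul h3'
    have h6 : (fun b : ℕ ↦ f b * f (-b) * (if b = 0 then (1 : ℂ) else
      (1 - w ^ 2 / (b : ℂ) ^ 2) * (1 - w ^ 2 / (b : ℂ) ^ 2)))
      = fun n : ℕ ↦ if n = 0 then f 0 * f 0 else
      (1 - (w + z) ^ 2 / (n : ℂ) ^ 2) * (1 - (w - z) ^ 2 / (n : ℂ) ^ 2) := by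
      funext n
      split_ifs with hn
      · simp [hn]
      · have a1 := hw n
        have a2 : w - n ≠ 0 := by simpa [sub_eq_add_neg] using hw (-n)
        have a3 : (n : ℂ) ≠ 0 := by exact_mod_cast hn
        simp only [hf]
        push_cast at a1 ⊢
        rw [← sub_eq_add_neg]
        field_simp
        ring
    rw [h6] at h5
    have h7 := h5.unique h4'
    simp only [if_true] at h7
    have h8 : (∏' n, f n) * (sincPi w * sincPi w) = f 0 * (sincPi (w + z) * sincPi (w - z)) := by
      refine mul_left_cancel₀ h0 ?_
      linear_combination h7
    convert h1 using 1
    rw [div_eq_iff (pow_ne_zero 2 hsw), ← mul_sincPi w, ← mul_sincPi (w + z), ← mul_sincPi (w - z)]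
    have h9 : w ^ 2 * f 0 = (w + z) * (w - z) := by
      simp only [hf, Int.cast_zero, add_zero]
      field_simp
      ring
    linear_combination (-(π : ℂ) ^ 2 * w ^ 2) * h8 - π ^ 2 * (sincPi (w + z) * sincPi (w - z)) * h9

end SineProduct

/-! ### Gaussian binomials and the q-binomial theorem. -/

section GaussianBinomial

variable {R : Type*} [CommRing R]

/-- The Gaussian binomial coefficient, by the `q`-analogue of Pascal's rule. -/
def gaussBinom (q : R) : ℕ → ℕ → R
  | _, 0 => 1
  | 0, _ + 1 => 0
  | M + 1, j + 1 => gaussBinom q M j + q ^ (j + 1) * gaussBinom q M (j + 1)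

lemma gaussBinom_eq_zero (q : R) : ∀ M j : ℕ, M < j → gaussBinom q M j = 0
  | _, 0, h => by omega
  | 0, _ + 1, _ => by simp [gaussBinom]
  | M + 1, j + 1, h => by
    rw [gaussBinom, gaussBinom_eq_zero q M j (by omega), gaussBinom_eq_zero q M (j + 1) (by omega)]
    simp

lemma gaussBinom_zero_right (q : R) (M : ℕ) : gaussBinom q M 0 = 1 := by
  cases M <;> simp [gaussBinom]

/-- The finite product `(1 - q) (1 - q ^ 2) ⋯ (1 - q ^ k)`. -/
def qFactorial (q : R) (k : ℕ) : R := ∏ i ∈ Finset.range k, (1 - q ^ (i + 1))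

lemma qFactorial_succ (q : R) (k : ℕ) :
    qFactorial q (k + 1) = qFactorial q k * (1 - q ^ (k + 1)) := Finset.prod_range_succ _ _

lemma gaussBinom_mul_qFactorial (q : R) : ∀ i j : ℕ,
    gaussBinom q (i + j) j * (qFactorial q j * qFactorial q i) = qFactorial q (i + j)
  | i, 0 => by simp [gaussBinom_zero_right, qFactorial]
  | 0, j + 1 => by
    have h := gaussBinom_mul_qFactorial q 0 j
    have h1 : gaussBinom q (0 + (j + 1)) (j + 1) = gaussBinom q (0 + j) j := by
      rw [← add_assoc, gaussBinom, gaussBinom_eq_zero q (0 + j) (j + 1) (by omega)]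
      simp
    rw [h1, ← add_assoc, qFactorial_succ, qFactorial_succ, ← h]
    simp only [zero_add]
    ring
  | i + 1, j + 1 => by
    have h1 := gaussBinom_mul_qFactorial q (i + 1) j
    have h2 := gaussBinom_mul_qFactorial q i (j + 1)
    have e : i + 1 + j = i + (j + 1) := by omega
    rw [← add_assoc, gaussBinom, qFactorial_succ q (i + 1 + j), ← h1]
    rw [← e, ← h1] at h2
    rw [qFactorial_succ q i] at *
    rw [qFactorial_succ q j] at *
    linear_combination q ^ (j + 1) * (1 - q ^ (i + 1)) * h2

/-- The q-binomial theorem: splitting off the factor `1 + x` replaces `x` by `xq` in the remaining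
ones, and the q-Pascal rule matches coefficients. -/
lemma prod_one_add_mul_pow_eq_sum_gaussBinom (q : R) (M : ℕ) : ∀ x : R,
    ∏ k ∈ Finset.range M, (1 + x * q ^ k)
      = ∑ j ∈ Finset.range (M + 1), gaussBinom q M j * q ^ (j.choose 2) * x ^ j := by
  induction M with
  | zero => intro x; simp [gaussBinom_zero_right]
  | succ M ih =>
    intro x
    rw [Finset.prod_range_succ']
    have h1 : ∏ k ∈ Finset.range M, (1 + x * q ^ (k + 1))
        = ∏ k ∈ Finset.range M, (1 + (x * q) * q ^ k) :=
      Finset.prod_congr rfl fun k _ ↦ by ring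
    rw [h1, ih, Finset.sum_range_succ' _ (M + 1), pow_zero, mul_one, mul_add, mul_one]
    have h2 : ∑ j ∈ Finset.range (M + 1),
        gaussBinom q (M + 1) (j + 1) * q ^ ((j + 1).choose 2) * x ^ (j + 1)
        = (∑ j ∈ Finset.range (M + 1), gaussBinom q M j * q ^ (j.choose 2) * (x * q) ^ j * x)
          + ∑ j ∈ Finset.range M,
            gaussBinom q M (j + 1) * q ^ ((j + 1).choose 2) * (x * q) ^ (j + 1) := by
      have h3 : ∑ j ∈ Finset.range M,
            gaussBinom q M (j + 1) * q ^ ((j + 1).choose 2) * (x * q) ^ (j + 1)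
          = ∑ j ∈ Finset.range (M + 1),
            gaussBinom q M (j + 1) * q ^ ((j + 1).choose 2) * (x * q) ^ (j + 1) := by
        rw [Finset.sum_range_succ, gaussBinom_eq_zero q M (M + 1) (by omega)]
        simp
      rw [h3, ← Finset.sum_add_distrib]
      refine Finset.sum_congr rfl fun j _ ↦ ?_
      rw [gaussBinom, Nat.choose_succ_succ' j 1, Nat.choose_one_right]
      ring
    rw [h2, ← Finset.sum_mul]
    nth_rewrite 1 [Finset.sum_range_succ' _ M]
    simp only [gaussBinom_zero_right, Nat.choose_zero_succ, pow_zero, mul_one]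
    ring

end GaussianBinomial

/-! ### Infinite q-products: convergence, zeros, continuity. -/

section EulerProduct

open Complex

/-- The infinite product `∏ (1 - u q ^ (n + 1))` over `n ≥ 0`. -/
noncomputable def eulerProd (q u : ℂ) : ℂ := ∏' n : ℕ, (1 - u * q ^ (n + 1))

variable {q : ℂ}

lemma summable_mul_pow_succ (hq : ‖q‖ < 1) (u : ℂ) :
    Summable fun n : ℕ ↦ ‖-(u * q ^ (n + 1))‖ := by
  simp only [norm_neg, norm_mul, norm_pow]
  exact ((summable_nat_add_iff 1).mpr
    (summable_geometric_of_lt_one (norm_nonneg _) hq)).mul_left _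

lemma hasProd_eulerProd (hq : ‖q‖ < 1) (u : ℂ) :
    HasProd (fun n : ℕ ↦ 1 - u * q ^ (n + 1)) (eulerProd q u) := by
  have := multipliable_one_add_of_summable (summable_mul_pow_succ hq u)
  simp only [← sub_eq_add_neg] at this
  exact this.hasProd

lemma eulerProd_ne_zero (hq : ‖q‖ < 1) {u : ℂ} (hu : ∀ n : ℕ, u * q ^ (n + 1) ≠ 1) :
    eulerProd q u ≠ 0 := by
  have := tprod_one_add_ne_zero_of_summable (f := fun n : ℕ ↦ -(u * q ^ (n + 1)))
    (fun n h ↦ hu n (by linear_combination -h)) (summable_mul_pow_succ hq u)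
  simp only [← sub_eq_add_neg] at this
  exact this

lemma pow_succ_ne_one (hq : ‖q‖ < 1) (n : ℕ) : q ^ (n + 1) ≠ 1 := by
  intro h
  have h1 : ‖q‖ ^ (n + 1) = 1 := by rw [← norm_pow, h, norm_one]
  exact (pow_lt_one₀ (norm_nonneg q) hq (by omega)).ne h1

lemma eulerProd_one_ne_zero (hq : ‖q‖ < 1) : eulerProd q 1 ≠ 0 :=
  eulerProd_ne_zero hq fun n ↦ by rw [one_mul]; exact pow_succ_ne_one hq n

lemma continuous_eulerProd (hq : ‖q‖ < 1) : Continuous (eulerProd q) := by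
  rw [continuous_iff_continuousAt]
  intro u
  have := tendsto_tprod_one_add_of_dominated_convergence (𝓕 := 𝓝 u)
    (f := fun (v : ℂ) (n : ℕ) ↦ -(v * q ^ (n + 1))) (g := fun n ↦ -(u * q ^ (n + 1)))
    (bound := fun n ↦ (‖u‖ + 1) * ‖q‖ ^ (n + 1))
    (((summable_nat_add_iff 1).mpr
      (summable_geometric_of_lt_one (norm_nonneg _) hq)).mul_left _)
    (fun n ↦ Continuous.tendsto (by fun_prop) u)
    (by
      have h : ∀ᶠ v : ℂ in 𝓝 u, ‖v‖ < ‖u‖ + 1 :=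
        continuous_norm.continuousAt.eventually_lt_const (by linarith)
      filter_upwards [h] with v hv n
      rw [norm_neg, norm_mul, norm_pow]
      gcongr)
  simp only [← sub_eq_add_neg] at this
  exact this

end EulerProduct

/-! ### The Jacobi triple product as a limit of its finite form. -/

section TripleProduct

open Complex

variable {p : ℂ}

lemma tendsto_qFactorial {q : ℂ} (hq : ‖q‖ < 1) :
    Tendsto (qFactorial q) atTop (𝓝 (eulerProd q 1)) := by
  have h := (hasProd_eulerProd hq 1).tendsto_prod_nat
  simp only [one_mul] at h
  exact h

lemma qFactorial_ne_zero {q : ℂ} (hq : ‖q‖ < 1) (k : ℕ) : qFactorial q k ≠ 0 :=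
  Finset.prod_ne_zero_iff.mpr fun i _ ↦ sub_ne_zero.mpr (pow_succ_ne_one hq i).symm

/-- The central Gaussian binomial coefficients, indexed symmetrically around the middle. -/
def centralGaussBinom {R : Type*} [CommRing R] (q : R) (N : ℕ) (n : ℤ) : R :=
  if -(N : ℤ) ≤ n then gaussBinom q (2 * N) (N + n).toNat else 0

lemma centralGaussBinom_eq_zero {R : Type*} [CommRing R] (q : R) {N : ℕ} {n : ℤ}
    (h : N < n.natAbs) : centralGaussBinom q N n = 0 := by
  unfold centralGaussBinom
  split_ifs with h1
  · exact gaussBinom_eq_zero _ _ _ (by omega)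
  · rfl

lemma centralGaussBinom_eq_div {q : ℂ} (hq : ‖q‖ < 1) {N : ℕ} {n : ℤ} (h : n.natAbs ≤ N) :
    centralGaussBinom q N n = qFactorial q (2 * N)
      * ((qFactorial q (N + n).toNat)⁻¹ * (qFactorial q (N - n).toNat)⁻¹) := by
  rw [centralGaussBinom, if_pos (by omega)]
  have h1 := gaussBinom_mul_qFactorial q (N - n).toNat (N + n).toNat
  rw [show (N - n).toNat + (N + n).toNat = 2 * N by omega] at h1
  have h2 := qFactorial_ne_zero hq (N - n).toNat
  have h3 := qFactorial_ne_zero hq (N + n).toNat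
  field_simp
  linear_combination h1

/-- The q-factorials converge to a nonzero limit, so they and their inverses are bounded. This
supplies the dominating constant for the passage to the limit. -/
lemma exists_norm_centralGaussBinom_le {q : ℂ} (hq : ‖q‖ < 1) :
    ∃ K, ∀ N n, ‖centralGaussBinom q N n‖ ≤ K := by
  obtain ⟨B, hB⟩ := (Metric.isBounded_range_of_tendsto _ (tendsto_qFactorial hq)).exists_norm_le
  obtain ⟨B', hB'⟩ := (Metric.isBounded_range_of_tendsto _
    ((tendsto_qFactorial hq).inv₀ (eulerProd_one_ne_zero hq))).exists_norm_le
  have h0 : 0 ≤ B := (norm_nonneg _).trans (hB _ ⟨0, rfl⟩)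
  have h0' : 0 ≤ B' := (norm_nonneg _).trans (hB' _ ⟨0, rfl⟩)
  refine ⟨B * (B' * B'), fun N n ↦ ?_⟩
  rcases le_or_gt n.natAbs N with h | h
  · rw [centralGaussBinom_eq_div hq h, norm_mul, norm_mul]
    gcongr
    · exact hB _ ⟨_, rfl⟩
    · exact hB' _ ⟨_, rfl⟩
    · exact hB' _ ⟨_, rfl⟩
  · rw [centralGaussBinom_eq_zero q h, norm_zero]
    positivity

lemma tendsto_centralGaussBinom {q : ℂ} (hq : ‖q‖ < 1) (n : ℤ) :
    Tendsto (fun N ↦ centralGaussBinom q N n) atTop (𝓝 (eulerProd q 1)⁻¹) := by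
  have h0 := eulerProd_one_ne_zero hq
  have t1 : Tendsto (fun N : ℕ ↦ 2 * N) atTop atTop :=
    tendsto_atTop_mono (fun N ↦ by simp only [id]; omega) tendsto_id
  have t2 : ∀ m : ℤ, Tendsto (fun N : ℕ ↦ (N + m).toNat) atTop atTop := fun m ↦
    tendsto_atTop_mono (fun N ↦ by omega) (tendsto_sub_atTop_nat m.natAbs)
  have h := ((tendsto_qFactorial hq).comp t1).mul
    ((((tendsto_qFactorial hq).comp (t2 n)).inv₀ h0).mul
      (((tendsto_qFactorial hq).comp (t2 (-n))).inv₀ h0))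
  rw [mul_inv_cancel_left₀ h0] at h
  refine h.congr' ?_
  filter_upwards [eventually_ge_atTop n.natAbs] with N hN
  rw [centralGaussBinom_eq_div hq hN]
  simp [sub_eq_add_neg]

lemma two_mul_choose_two_cast (j : ℕ) : (2 * (j.choose 2 : ℕ) : ℤ) = (j : ℤ) ^ 2 - j := by
  induction j with
  | zero => simp
  | succ j ih =>
    rw [Nat.choose_succ_succ' j 1, Nat.choose_one_right]
    push_cast
    linarith

lemma prod_neg_mul_zpow (hp : p ≠ 0) (x : ℂ) (N : ℕ) :
    ∏ i ∈ Finset.range N, (-x * p ^ (-2 * (i : ℤ))) = (-x) ^ N * p ^ ((N : ℤ) - N ^ 2) := by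
  induction N with
  | zero => simp
  | succ N ih =>
    rw [Finset.prod_range_succ, ih]
    have : ((N + 1 : ℕ) : ℤ) - ((N + 1 : ℕ) : ℤ) ^ 2 = ((N : ℤ) - N ^ 2) + -2 * (N : ℤ) := by
      push_cast; ring
    rw [this, zpow_add₀ hp]
    ring

/-- This is the q-binomial theorem with `2N` factors, the argument being shifted so that the
exponents straddle zero. The upper half gives the factors in `x`; the lower half gives those in
`x⁻¹` after a monomial is pulled out of each, and that monomial cancels on both sides. -/
lemma finite_triple_product (hp : p ≠ 0) {x : ℂ} (hx : x ≠ 0) (N : ℕ) :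
    (∏ i ∈ Finset.range N, (1 - x * (p ^ 2) ^ (i + 1)))
        * ∏ i ∈ Finset.range N, (1 - x⁻¹ * (p ^ 2) ^ i)
      = ∑ j ∈ Finset.range (2 * N + 1), gaussBinom (p ^ 2) (2 * N) j
        * (p ^ (((j : ℤ) - N) ^ 2 + ((j : ℤ) - N)) * (-x) ^ ((j : ℤ) - N)) := by
  have hx' : -x ≠ 0 := neg_ne_zero.mpr hx
  have h1 := prod_one_add_mul_pow_eq_sum_gaussBinom (p ^ 2) (2 * N) (-x * p ^ (2 - 2 * (N : ℤ)))
  rw [two_mul, Finset.prod_range_add, ← Finset.prod_range_reflect] at h1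
  have h2 : ∏ j ∈ Finset.range N, (1 + -x * p ^ (2 - 2 * (N : ℤ)) * (p ^ 2) ^ (N - 1 - j))
      = (∏ i ∈ Finset.range N, (-x * p ^ (-2 * (i : ℤ))))
        * ∏ i ∈ Finset.range N, (1 - x⁻¹ * (p ^ 2) ^ i) := by
    rw [← Finset.prod_mul_distrib]
    refine Finset.prod_congr rfl fun i hi ↦ ?_
    have hi' := Finset.mem_range.mp hi
    have e1 : p ^ (2 - 2 * (N : ℤ)) * (p ^ 2) ^ (N - 1 - i) = p ^ (-2 * (i : ℤ)) := by
      rw [← pow_mul, ← zpow_natCast p, ← zpow_add₀ hp]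
      congr 1
      push_cast [show i ≤ N - 1 by omega, show 1 ≤ N by omega]
      ring
    have e2 : p ^ (-2 * (i : ℤ)) * (p ^ 2) ^ i = 1 := by
      rw [← pow_mul, ← zpow_natCast p, ← zpow_add₀ hp]
      push_cast
      rw [show -2 * (i : ℤ) + 2 * i = 0 by ring, zpow_zero]
    rw [mul_assoc, e1]
    have e3 : x * x⁻¹ = 1 := mul_inv_cancel₀ hx
    linear_combination -(x * x⁻¹) * e2 - e3
  have h3 : ∏ i ∈ Finset.range N, (1 + -x * p ^ (2 - 2 * (N : ℤ)) * (p ^ 2) ^ (N + i))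
      = ∏ i ∈ Finset.range N, (1 - x * (p ^ 2) ^ (i + 1)) := by
    refine Finset.prod_congr rfl fun i _ ↦ ?_
    have e1 : p ^ (2 - 2 * (N : ℤ)) * (p ^ 2) ^ (N + i) = (p ^ 2) ^ (i + 1) := by
      rw [← pow_mul, ← pow_mul, ← zpow_natCast p, ← zpow_natCast p, ← zpow_add₀ hp]
      congr 1
      push_cast
      ring
    rw [mul_assoc, e1]
    ring
  rw [h2, h3, prod_neg_mul_zpow hp, ← two_mul] at h1
  have hc : (-x) ^ N * p ^ ((N : ℤ) - N ^ 2) ≠ 0 :=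
    mul_ne_zero (pow_ne_zero _ hx') (zpow_ne_zero _ hp)
  refine mul_left_cancel₀ hc ?_
  rw [Finset.mul_sum]
  rw [mul_comm (∏ i ∈ Finset.range N, (1 - x * (p ^ 2) ^ (i + 1))), ← mul_assoc, h1]
  refine Finset.sum_congr rfl fun j _ ↦ ?_
  have e1 : (p ^ 2) ^ (j.choose 2) = p ^ ((j : ℤ) ^ 2 - j) := by
    rw [← pow_mul, ← zpow_natCast p, ← two_mul_choose_two_cast]
    push_cast
    rfl
  have e2 : (-x) ^ N * (-x) ^ ((j : ℤ) - N) = (-x) ^ j := by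
    rw [← zpow_natCast (-x) N, ← zpow_natCast (-x) j, ← zpow_add₀ hx']
    congr 1
    ring
  have e3 : p ^ ((j : ℤ) ^ 2 - j) * p ^ ((2 - 2 * (N : ℤ)) * j)
      = p ^ ((N : ℤ) - N ^ 2) * p ^ (((j : ℤ) - N) ^ 2 + ((j : ℤ) - N)) := by
    rw [← zpow_add₀ hp, ← zpow_add₀ hp]
    congr 1
    ring
  rw [e1, mul_pow, ← zpow_natCast (p ^ (2 - 2 * (N : ℤ))) j, ← zpow_mul, ← e2]
  linear_combination gaussBinom (p ^ 2) (2 * N) j * (-x) ^ N * (-x) ^ ((j : ℤ) - N) * e3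

lemma tsum_centralGaussBinom_mul (q : ℂ) (N : ℕ) (f : ℤ → ℂ) :
    ∑' n : ℤ, centralGaussBinom q N n * f n
      = ∑ j ∈ Finset.range (2 * N + 1), gaussBinom q (2 * N) j * f ((j : ℤ) - N) := by
  rw [tsum_eq_sum (s := (Finset.range (2 * N + 1)).image fun j : ℕ ↦ (j : ℤ) - N),
    Finset.sum_image fun a _ b _ h ↦ by simpa using h]
  · refine Finset.sum_congr rfl fun j _ ↦ ?_
    rw [centralGaussBinom, if_pos (by omega)]
    congr 2
    omega
  · intro n hn
    rw [centralGaussBinom_eq_zero, zero_mul]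
    by_contra h
    refine hn (Finset.mem_image.mpr ⟨(N + n).toNat, ?_, ?_⟩)
    · rw [Finset.mem_range]; omega
    · omega

/-- The Jacobi triple product identity. -/
theorem jacobi_triple_product (hp : p ≠ 0) (hp1 : ‖p‖ < 1) {x : ℂ} (hx : x ≠ 0)
    (hs : Summable fun n : ℤ ↦ p ^ (n ^ 2 + n) * (-x) ^ n) :
    ∑' n : ℤ, p ^ (n ^ 2 + n) * (-x) ^ n
      = eulerProd (p ^ 2) 1 * (eulerProd (p ^ 2) x * ((1 - x⁻¹) * eulerProd (p ^ 2) x⁻¹)) := by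
  have hq : ‖p ^ 2‖ < 1 := by
    rw [norm_pow]
    exact pow_lt_one₀ (norm_nonneg p) hp1 (by norm_num)
  obtain ⟨K, hK⟩ := exists_norm_centralGaussBinom_le hq
  have h1 := tendsto_tsum_of_dominated_convergence (𝓕 := atTop)
    (f := fun (N : ℕ) (n : ℤ) ↦ centralGaussBinom (p ^ 2) N n * (p ^ (n ^ 2 + n) * (-x) ^ n))
    (hs.norm.mul_left K) (fun n ↦ (tendsto_centralGaussBinom hq n).mul_const _)
    (Eventually.of_forall fun N n ↦ by
      rw [norm_mul]
      gcongr
      exact hK N n)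
  simp_rw [tsum_centralGaussBinom_mul (p ^ 2) _ (fun n ↦ p ^ (n ^ 2 + n) * (-x) ^ n),
    ← finite_triple_product hp hx] at h1
  have h2 := (hasProd_eulerProd hq x).tendsto_prod_nat
  -- The product in `x⁻¹` starts at exponent `0`, whereas `eulerProd` starts at `1`; the extra
  -- factor is `1 - x⁻¹`.
  have h3 := (HasProd.zero_mul (f := fun n : ℕ ↦ 1 - x⁻¹ * (p ^ 2) ^ n)
    (hasProd_eulerProd hq x⁻¹)).tendsto_prod_nat
  have h4 := tendsto_nhds_unique h1 (h2.mul h3)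
  rw [tsum_mul_left] at h4
  rw [pow_zero, mul_one] at h4
  rw [← h4, mul_inv_cancel_left₀ (eulerProd_one_ne_zero hq)]

end TripleProduct

/-! ### Product formula for the modified theta function. -/

section ThetaTilde

open Complex
open scoped Real

/-- `∏ (1 - u qⁿ) (1 - u⁻¹ qⁿ) / (1 - qⁿ) ^ 2` over `n ≥ 1`, where `u = exp (2 π i z)` and
`q = exp (2 π i τ)`. -/
noncomputable def thetaProd (z τ : ℂ) : ℂ :=
  eulerProd (exp (2 * π * I * τ)) (exp (2 * π * I * z))
    * eulerProd (exp (2 * π * I * τ)) (exp (2 * π * I * z))⁻¹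
    / eulerProd (exp (2 * π * I * τ)) 1 ^ 2

variable {τ : ℂ}

lemma norm_exp_two_pi_I_mul_lt_one (hτ : 0 < τ.im) : ‖exp (2 * π * I * τ)‖ < 1 :=
  UpperHalfPlane.norm_exp_two_pi_I_lt_one ⟨τ, hτ⟩

/-- The shift by `τ/2 + 1/2` turns the theta terms into `p^(n²+n) (-u)ⁿ` with `p = exp (πiτ)`, the
shape of the triple product with `x = u`. -/
lemma jacobiTheta₂_shift_eq (hτ : 0 < τ.im) (z : ℂ) :
    jacobiTheta₂ (z + τ / 2 + 1 / 2) τ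
      = eulerProd (exp (2 * π * I * τ)) 1 * (eulerProd (exp (2 * π * I * τ)) (exp (2 * π * I * z))
        * ((1 - (exp (2 * π * I * z))⁻¹)
          * eulerProd (exp (2 * π * I * τ)) (exp (2 * π * I * z))⁻¹)) := by
  have hterm : ∀ n : ℤ, jacobiTheta₂_term n (z + τ / 2 + 1 / 2) τ
      = exp (π * I * τ) ^ (n ^ 2 + n) * (-exp (2 * π * I * z)) ^ n := by
    intro n
    have : -exp (2 * π * I * z) = exp (2 * π * I * z + π * I) := by
      rw [exp_add, exp_pi_mul_I]; ring
    rw [this, ← exp_int_mul, ← exp_int_mul, ← exp_add, jacobiTheta₂_term]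
    congr 1
    push_cast
    ring
  have hs := (hasSum_jacobiTheta₂_term (z + τ / 2 + 1 / 2) hτ).summable
  have hp1 : ‖exp (π * I * τ)‖ < 1 := by
    rw [norm_exp, Real.exp_lt_one_iff]
    simp
    positivity
  have hp2 : exp (π * I * τ) ^ 2 = exp (2 * π * I * τ) := by
    rw [← exp_nat_mul]; congr 1; push_cast; ring
  rw [jacobiTheta₂]
  simp_rw [hterm] at hs ⊢
  rw [jacobi_triple_product (exp_ne_zero _) hp1 (exp_ne_zero _) hs, hp2]

lemma eta_pow_three_eq :
    ModularForm.eta τ ^ 3 = exp (2 * π * I * τ / 8) * eulerProd (exp (2 * π * I * τ)) 1 ^ 3 := by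
  rw [ModularForm.eta, mul_pow, eulerProd]
  simp_rw [ModularForm.eta_q_eq_pow, one_mul]
  congr 1
  rw [Function.Periodic.qParam, ← exp_nat_mul]
  congr 1
  push_cast
  ring

/-- The factor `q^(1/8)` cancels that of `η³`, and `u^(1/2) (1 - u⁻¹) = 2i sin πz`. -/
lemma thetaTilde_eq (hτ : 0 < τ.im) (z : ℂ) :
    thetaTilde z τ = exp (π / 2 * (z ^ 2 / τ.im)) * (2 * I * sin (π * z)) * thetaProd z τ := by
  have h0 := eulerProd_one_ne_zero (norm_exp_two_pi_I_mul_lt_one hτ)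
  have h1 := exp_ne_zero (2 * π * I * τ / 8)
  have h2 : exp (π * I * z) * (1 - (exp (2 * π * I * z))⁻¹) = 2 * I * sin (π * z) := by
    rw [sin, mul_sub, mul_one, ← exp_neg, ← exp_add,
      show π * I * z + -(2 * π * I * z) = -(π * z) * I by ring,
      show π * I * z = (π * z) * I by ring]
    linear_combination (exp (π * z * I) - exp (-(π * z) * I)) * I_sq
  rw [thetaTilde, jacobiTheta₂_shift_eq hτ, eta_pow_three_eq, thetaProd, ← h2]
  field_simp

lemma continuous_thetaProd (hτ : 0 < τ.im) : Continuous fun z ↦ thetaProd z τ := by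
  have h := continuous_eulerProd (norm_exp_two_pi_I_mul_lt_one hτ)
  unfold thetaProd
  refine Continuous.div_const (Continuous.mul (h.comp (by fun_prop)) (h.comp ?_)) _
  exact Continuous.inv₀ (by fun_prop) fun z ↦ exp_ne_zero _

lemma thetaProd_zero (hτ : 0 < τ.im) : thetaProd 0 τ = 1 := by
  have h0 := eulerProd_one_ne_zero (norm_exp_two_pi_I_mul_lt_one hτ)
  simp [thetaProd]
  field_simp

lemma thetaProd_ne_zero (hτ : 0 < τ.im) {z : ℂ} (hz : ∀ m n : ℤ, z ≠ m * τ + n) :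
    thetaProd z τ ≠ 0 := by
  have hq := norm_exp_two_pi_I_mul_lt_one hτ
  have hpi : 2 * (π : ℂ) * I ≠ 0 := two_pi_I_ne_zero
  refine div_ne_zero (mul_ne_zero (eulerProd_ne_zero hq fun n h ↦ ?_)
    (eulerProd_ne_zero hq fun n h ↦ ?_)) (pow_ne_zero 2 (eulerProd_one_ne_zero hq))
  · rw [← exp_nat_mul, ← exp_add, exp_eq_one_iff] at h
    obtain ⟨k, hk⟩ := h
    refine hz (-(n + 1)) k (mul_left_cancel₀ hpi ?_)
    push_cast at hk ⊢
    linear_combination hk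
  · rw [← exp_nat_mul, ← exp_neg, ← exp_add, exp_eq_one_iff] at h
    obtain ⟨k, hk⟩ := h
    refine hz (n + 1) (-k) (mul_left_cancel₀ hpi ?_)
    push_cast at hk ⊢
    linear_combination -hk

/-- Written in exponentials, the sine quotient of row `m = M + 1` is `(1 - u qᵐ)(1 - u⁻¹ qᵐ)/(1 -
qᵐ)²`. This is how the rows of the lattice product become theta factors. -/
lemma hasProd_thetaProd (hτ : 0 < τ.im) (z : ℂ) :
    HasProd (fun M : ℕ ↦ sin (π * ((M + 1) * τ + z)) * sin (π * ((M + 1) * τ - z))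
      / sin (π * ((M + 1) * τ)) ^ 2) (thetaProd z τ) := by
  have hq := norm_exp_two_pi_I_mul_lt_one hτ
  have h0 := eulerProd_one_ne_zero hq
  have hA := (hasProd_eulerProd hq (exp (2 * π * I * z))).mul
    (hasProd_eulerProd hq (exp (2 * π * I * z))⁻¹)
  have hne : ∀ n : ℕ, 1 - exp (2 * π * I * τ) ^ (n + 1) ≠ 0 := fun n ↦
    sub_ne_zero.mpr (pow_succ_ne_one hq n).symm
  have hB := (hasProd_eulerProd hq 1).mul (hasProd_eulerProd hq 1)
  have hAB := hA.div₀ hB (mul_ne_zero h0 h0)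
  rw [thetaProd, sq]
  refine hAB.congr_fun fun n ↦ ?_
  have hn := hne n
  have e1 : exp (2 * π * I * τ) ^ (n + 1) = exp (π * ((n + 1) * τ) * I) ^ 2 := by
    rw [← exp_nat_mul, ← exp_nat_mul]; congr 1; push_cast; ring
  have e2 : exp (2 * π * I * z) = exp (π * z * I) ^ 2 := by
    rw [← exp_nat_mul]; congr 1; push_cast; ring
  have s1 : ∀ w : ℂ, sin w = ((exp (w * I))⁻¹ - exp (w * I)) * I / 2 := fun w ↦ by
    rw [sin, ← exp_neg, neg_mul]
  rw [e1] at hn ⊢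
  have e4 : exp (π * ((n + 1) * τ + z) * I)
      = exp (π * ((n + 1) * τ) * I) * exp (π * z * I) := by rw [← exp_add]; ring_nf
  have e5 : exp (π * ((n + 1) * τ - z) * I)
      = exp (π * ((n + 1) * τ) * I) / exp (π * z * I) := by rw [← exp_sub]; ring_nf
  rw [e2, s1, s1, s1, e4, e5]
  have hE := exp_ne_zero (π * ((n + 1) * τ) * I)
  have hU := exp_ne_zero (π * z * I)
  set E := exp (π * ((n + 1) * τ) * I)
  set U := exp (π * z * I)
  rw [one_mul]
  have hI := I_ne_zero
  have hE2 : E⁻¹ - E ≠ 0 := by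
    intro h
    refine hn ?_
    field_simp at h
    simpa using h
  have e3 : E⁻¹ - E = (1 - E ^ 2) / E := by field_simp
  rw [e3]
  field_simp

end ThetaTilde

/-! ### The real-variable kernel behind Hecke's trick and its integral. -/

section HeckeKernel

open Complex MeasureTheory
open scoped Real

/-- The function `(u + i)⁻² |u + i|⁻ˢ` of a real variable `u`. -/
noncomputable def heckeKernel (s u : ℝ) : ℂ := (((u : ℂ) + I) ^ 2)⁻¹ * (((1 + u ^ 2) ^ (-s / 2) : ℝ) : ℂ)

/-- The function `u (u - i) |u + i|⁻⁴⁻ˢ` of a real variable `u`. -/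
noncomputable def heckeKernelAux (s u : ℝ) : ℂ :=
  ((u : ℂ) * (u - I)) * (((1 + u ^ 2) ^ (-s / 2 - 2) : ℝ) : ℂ)

lemma ofReal_add_I_ne_zero (u : ℝ) : (u : ℂ) + I ≠ 0 := by
  intro h
  simpa using congrArg Complex.im h

lemma norm_ofReal_add_I_sq (u : ℝ) : ‖(u : ℂ) + I‖ ^ 2 = 1 + u ^ 2 := by
  rw [Complex.sq_norm, Complex.normSq_apply]
  simp
  ring

lemma norm_ofReal_sub_I_sq (u : ℝ) : ‖(u : ℂ) - I‖ ^ 2 = 1 + u ^ 2 := by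
  rw [Complex.sq_norm, Complex.normSq_apply]
  simp
  ring

lemma one_add_sq_rpow_le_one {s : ℝ} (hs : 0 ≤ s) (u : ℝ) : (1 + u ^ 2) ^ (-s / 2) ≤ 1 :=
  Real.rpow_le_one_of_one_le_of_nonpos (by nlinarith [sq_nonneg u]) (by linarith)

lemma norm_heckeKernel_le {s : ℝ} (hs : 0 ≤ s) (u : ℝ) : ‖heckeKernel s u‖ ≤ (1 + u ^ 2)⁻¹ := by
  rw [heckeKernel, norm_mul, norm_inv, norm_pow, norm_ofReal_add_I_sq, Complex.norm_real,
    Real.norm_of_nonneg (by positivity)]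
  exact mul_le_of_le_one_right (by positivity) (one_add_sq_rpow_le_one hs u)

lemma norm_heckeKernelAux_le {s : ℝ} (hs : 0 ≤ s) (u : ℝ) :
    ‖heckeKernelAux s u‖ ≤ (1 + u ^ 2)⁻¹ := by
  have h0 : 0 < 1 + u ^ 2 := by positivity
  have h1 : ‖(u : ℂ)‖ ≤ ‖(u : ℂ) - I‖ := by
    refine abs_le_of_sq_le_sq' ?_ (norm_nonneg _) |>.2
    rw [norm_ofReal_sub_I_sq, Complex.norm_real, Real.norm_eq_abs, sq_abs]
    linarith
  rw [heckeKernelAux, norm_mul, norm_mul, Complex.norm_real (_ ^ _),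
    Real.norm_of_nonneg (by positivity), Real.rpow_sub h0, Real.rpow_two]
  calc _ ≤ ‖(u : ℂ) - I‖ * ‖(u : ℂ) - I‖ * (1 / (1 + u ^ 2) ^ 2) := by
        gcongr
        exact one_add_sq_rpow_le_one hs u
    _ = _ := by
      rw [← sq, norm_ofReal_sub_I_sq]
      field_simp

lemma continuous_one_add_sq_rpow {r : ℝ → ℝ} (hr : Continuous r) :
    Continuous fun x : ℝ × ℝ ↦ (((1 + x.2 ^ 2) ^ r x.1 : ℝ) : ℂ) := by
  refine continuous_ofReal.comp (Continuous.rpow (by fun_prop) (by fun_prop) fun x ↦ Or.inl ?_)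
  positivity

lemma continuous_heckeKernel_uncurry : Continuous (Function.uncurry heckeKernel) := by
  have h1 : Continuous fun x : ℝ × ℝ ↦ (((x.2 : ℂ) + I) ^ 2)⁻¹ :=
    Continuous.inv₀ (by fun_prop) fun x ↦ pow_ne_zero 2 (ofReal_add_I_ne_zero _)
  refine (h1.mul (continuous_one_add_sq_rpow (r := fun s ↦ -s / 2) (by fun_prop))).congr fun x ↦ ?_
  rw [Function.uncurry, heckeKernel, Pi.mul_apply]

lemma continuous_heckeKernel (s : ℝ) : Continuous (heckeKernel s) :=
  continuous_heckeKernel_uncurry.uncurry_left s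

lemma continuous_heckeKernel_comp {X : Type*} [TopologicalSpace X] {f g : X → ℝ}
    (hf : Continuous f) (hg : Continuous g) : Continuous fun x ↦ heckeKernel (f x) (g x) := by
  have h := continuous_heckeKernel_uncurry.comp (hf.prodMk hg)
  simp only [Function.comp_def, Function.uncurry] at h
  exact h

lemma continuous_heckeKernelAux_uncurry : Continuous (Function.uncurry heckeKernelAux) := by
  have h1 : Continuous fun x : ℝ × ℝ ↦ (x.2 : ℂ) * (x.2 - I) := by fun_prop
  exact h1.mul (continuous_one_add_sq_rpow (r := fun s ↦ -s / 2 - 2) (by fun_prop))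

lemma integrable_heckeKernel {s : ℝ} (hs : 0 ≤ s) : Integrable (heckeKernel s) :=
  integrable_inv_one_add_sq.mono' (continuous_heckeKernel s).aestronglyMeasurable
    (Eventually.of_forall fun u ↦ norm_heckeKernel_le hs u)

lemma integrable_heckeKernelAux {s : ℝ} (hs : 0 ≤ s) : Integrable (heckeKernelAux s) :=
  integrable_inv_one_add_sq.mono'
    (continuous_heckeKernelAux_uncurry.uncurry_left s).aestronglyMeasurable
    (Eventually.of_forall fun u ↦ norm_heckeKernelAux_le hs u)

lemma hasDerivAt_one_add_sq_rpow (r u : ℝ) :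
    HasDerivAt (fun u : ℝ ↦ (((1 + u ^ 2) ^ r : ℝ) : ℂ))
      ((2 * r * u * (1 + u ^ 2) ^ (r - 1) : ℝ) : ℂ) u := by
  have h1 : HasDerivAt (fun u : ℝ ↦ 1 + u ^ 2) (2 * u) u := by
    simpa using ((hasDerivAt_id u).pow 2).const_add 1
  have h2 := h1.rpow_const (p := r) (Or.inl (by positivity))
  refine h2.ofReal_comp.congr_deriv ?_
  push_cast
  ring

lemma hasDerivAt_ofReal_add_I_inv (u : ℝ) :
    HasDerivAt (fun u : ℝ ↦ ((u : ℂ) + I)⁻¹) (-(((u : ℂ) + I) ^ 2)⁻¹) u := by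
  have h1 : HasDerivAt (fun u : ℝ ↦ (u : ℂ) + I) 1 u := by
    simpa using ((hasDerivAt_id u).ofReal_comp).add_const I
  refine (h1.inv (ofReal_add_I_ne_zero u)).congr_deriv ?_
  rw [neg_div, one_div]

lemma ofReal_sub_I_mul (u : ℝ) : ((u : ℂ) - I) * (u + I) = 1 + u ^ 2 := by
  linear_combination -I_sq

/-- The primitive at `s = 0` times `|u+i|⁻ˢ` is a primitive of the kernel up to a term carrying a
factor `s`. -/
lemma hasDerivAt_heckePrimitive (s u : ℝ) :
    HasDerivAt (fun u : ℝ ↦ ((u : ℂ) + I)⁻¹ * (((1 + u ^ 2) ^ (-s / 2) : ℝ) : ℂ))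
      (-heckeKernel s u - s * heckeKernelAux s u) u := by
  refine ((hasDerivAt_ofReal_add_I_inv u).mul
    (hasDerivAt_one_add_sq_rpow (-s / 2) u)).congr_deriv ?_
  rw [heckeKernel, heckeKernelAux]
  have h0 : 0 < 1 + u ^ 2 := by positivity
  have h1 : (1 + u ^ 2) ^ (-s / 2 - 1) = (1 + u ^ 2) ^ (-s / 2 - 2) * (1 + u ^ 2) := by
    rw [← Real.rpow_add_one h0.ne']; ring_nf
  rw [h1]
  push_cast
  rw [← ofReal_sub_I_mul]
  have := ofReal_add_I_ne_zero u
  field_simp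
  ring

lemma tendsto_norm_ofReal_add_I_inv {l : Filter ℝ} (hl : Tendsto (fun u : ℝ ↦ |u|) l atTop) :
    Tendsto (fun u : ℝ ↦ ‖((u : ℂ) + I)⁻¹‖) l (𝓝 0) := by
  have h : Tendsto (fun u : ℝ ↦ ‖(u : ℂ) + I‖) l atTop := by
    refine tendsto_atTop_mono (fun u ↦ ?_) hl
    simpa using Complex.abs_re_le_norm ((u : ℂ) + I)
  simp only [norm_inv]
  exact h.inv_tendsto_atTop

/-- The boundary terms of the primitive vanish. The explicit factor `s` is what cancels the pole of
`ζ(1+s)` after summing over rows. -/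
lemma integral_heckeKernel {s : ℝ} (hs : 0 ≤ s) :
    ∫ u, heckeKernel s u = -s * ∫ u, heckeKernelAux s u := by
  have hl : ∀ l : Filter ℝ, Tendsto (fun u : ℝ ↦ |u|) l atTop →
      Tendsto (fun u : ℝ ↦ ((u : ℂ) + I)⁻¹ * (((1 + u ^ 2) ^ (-s / 2) : ℝ) : ℂ)) l (𝓝 0) := by
    intro l hl
    refine squeeze_zero_norm (fun u ↦ ?_) (tendsto_norm_ofReal_add_I_inv hl)
    rw [norm_mul, Complex.norm_real, Real.norm_of_nonneg (by positivity)]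
    exact mul_le_of_le_one_right (norm_nonneg _) (one_add_sq_rpow_le_one hs u)
  have h := integral_of_hasDerivAt_of_tendsto (hasDerivAt_heckePrimitive s)
    ((integrable_heckeKernel hs).neg.sub ((integrable_heckeKernelAux hs).const_mul (s : ℂ)))
    (hl _ tendsto_abs_atBot_atTop) (hl _ tendsto_abs_atTop_atTop)
  have h' : ∫ u, (-heckeKernel s u - s * heckeKernelAux s u)
      = (∫ u, -heckeKernel s u) - ∫ u, s * heckeKernelAux s u :=
    integral_sub (integrable_heckeKernel hs).neg ((integrable_heckeKernelAux hs).const_mul _)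
  rw [h', integral_neg, integral_const_mul] at h
  linear_combination -h

/-- A primitive is `arctan u / 2 - 1/(2(u+i))`; only the arctangent contributes at infinity. -/
lemma integral_heckeKernelAux_zero : ∫ u, heckeKernelAux 0 u = π / 2 := by
  have hd : ∀ u : ℝ, HasDerivAt (fun u : ℝ ↦ ((Real.arctan u / 2 : ℝ) : ℂ)
      - (1 / 2) * ((u : ℂ) + I)⁻¹) (heckeKernelAux 0 u) u := by
    intro u
    have h1 := ((Real.hasDerivAt_arctan u).div_const 2).ofReal_comp
    refine (h1.sub ((hasDerivAt_ofReal_add_I_inv u).const_mul (1 / 2))).congr_deriv ?_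
    have h0 := ofReal_add_I_ne_zero u
    have h2 : (1 : ℂ) + u ^ 2 ≠ 0 := by exact_mod_cast (by positivity : (1 : ℝ) + u ^ 2 ≠ 0)
    have h3 : (u : ℂ) - I ≠ 0 := fun h ↦ h2 (by rw [← ofReal_sub_I_mul, h, zero_mul])
    have h4 : (1 + u ^ 2) ^ (-(0 : ℝ) / 2 - 2) = ((1 + u ^ 2) ^ 2)⁻¹ := by
      rw [show -(0 : ℝ) / 2 - 2 = -2 by norm_num, Real.rpow_neg (by positivity), Real.rpow_two]
    rw [heckeKernelAux, h4]
    push_cast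
    rw [← ofReal_sub_I_mul]
    field_simp
    ring
  have hl : ∀ l : Filter ℝ, Tendsto (fun u : ℝ ↦ |u|) l atTop → ∀ a : ℝ,
      Tendsto Real.arctan l (𝓝 a) → Tendsto (fun u : ℝ ↦ ((Real.arctan u / 2 : ℝ) : ℂ)
      - (1 / 2) * ((u : ℂ) + I)⁻¹) l (𝓝 (((a / 2 : ℝ) : ℂ) - (1 / 2) * 0)) := by
    intro l hl a ha
    refine ((continuous_ofReal.tendsto _).comp (ha.div_const 2)).sub (Tendsto.const_mul _ ?_)
    exact tendsto_zero_iff_norm_tendsto_zero.mpr (tendsto_norm_ofReal_add_I_inv hl)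
  rw [integral_of_hasDerivAt_of_tendsto hd (integrable_heckeKernelAux le_rfl)
    (hl _ tendsto_abs_atBot_atTop _ (tendsto_nhds_of_tendsto_nhdsWithin Real.tendsto_arctan_atBot))
    (hl _ tendsto_abs_atTop_atTop _ (tendsto_nhds_of_tendsto_nhdsWithin Real.tendsto_arctan_atTop))]
  push_cast
  ring

lemma tendsto_integral_heckeKernelAux :
    Tendsto (fun s : ℝ ↦ ∫ u, heckeKernelAux s u) (𝓝[>] 0) (𝓝 (π / 2)) := by
  rw [← integral_heckeKernelAux_zero]
  refine tendsto_integral_filter_of_dominated_convergence (fun u : ℝ ↦ (1 + u ^ 2)⁻¹) ?_ ?_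
    integrable_inv_one_add_sq ?_
  · exact Eventually.of_forall fun s ↦
      (continuous_heckeKernelAux_uncurry.uncurry_left s).aestronglyMeasurable
  · filter_upwards [self_mem_nhdsWithin] with s hs
    exact Eventually.of_forall fun u ↦ norm_heckeKernelAux_le (le_of_lt hs) u
  · refine Eventually.of_forall fun u ↦ ?_
    exact ((continuous_heckeKernelAux_uncurry.comp (Continuous.prodMk_left u)).tendsto
      0).mono_left nhdsWithin_le_nhds

/-- Differentiation gains one power of decay, and cubic decay is summable over the lattice even at
`s = 0`. -/
lemma exists_hasDerivAt_heckeKernel {s : ℝ} (hs : 0 ≤ s) (u : ℝ) :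
    ∃ d : ℂ, HasDerivAt (heckeKernel s) d u ∧ ‖d‖ ≤ (2 + s) * (‖(u : ℂ) + I‖ ^ 3)⁻¹ := by
  have h0 := ofReal_add_I_ne_zero u
  have hp : 0 < ‖(u : ℂ) + I‖ := norm_pos_iff.mpr h0
  have h1 : HasDerivAt (fun u : ℝ ↦ (((u : ℂ) + I) ^ 2)⁻¹) (-2 * (((u : ℂ) + I) ^ 3)⁻¹) u := by
    have h2 := (hasDerivAt_ofReal_add_I_inv u).mul (hasDerivAt_ofReal_add_I_inv u)
    have e : (fun u : ℝ ↦ (((u : ℂ) + I) ^ 2)⁻¹)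
        = (fun u : ℝ ↦ ((u : ℂ) + I)⁻¹) * fun u : ℝ ↦ ((u : ℂ) + I)⁻¹ := by
      funext v; simp [sq]
    rw [e]
    refine h2.congr_deriv ?_
    field_simp
    ring
  refine ⟨_, h1.mul (hasDerivAt_one_add_sq_rpow (-s / 2) u), ?_⟩
  have hq : 0 < 1 + u ^ 2 := by positivity
  have hu : |u| ≤ ‖(u : ℂ) + I‖ := by simpa using Complex.abs_re_le_norm ((u : ℂ) + I)
  have hr := one_add_sq_rpow_le_one hs u
  have hr0 : 0 ≤ (1 + u ^ 2) ^ (-s / 2) := by positivity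
  refine (norm_add_le _ _).trans ?_
  rw [add_mul]
  refine add_le_add ?_ ?_
  · rw [norm_mul, norm_mul, Complex.norm_real, Real.norm_of_nonneg hr0]
    simp only [norm_neg, Complex.norm_ofNat, norm_inv, norm_pow]
    exact mul_le_of_le_one_right (by positivity) hr
  · rw [norm_mul, Complex.norm_real, Real.rpow_sub_one hq.ne', ← norm_ofReal_add_I_sq]
    rw [← norm_ofReal_add_I_sq] at hr hr0
    simp only [norm_mul, norm_inv, norm_pow, norm_div, Real.norm_eq_abs, abs_norm, abs_neg,
      abs_of_nonneg hs, abs_of_nonneg hr0, abs_two]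
    have e : (‖(u : ℂ) + I‖ ^ 2)⁻¹ * (2 * (s / 2) * |u| * ((‖(u : ℂ) + I‖ ^ 2) ^ (-s / 2)
        / ‖(u : ℂ) + I‖ ^ 2)) ≤ (‖(u : ℂ) + I‖ ^ 2)⁻¹ * (2 * (s / 2) * ‖(u : ℂ) + I‖ * (1
        / ‖(u : ℂ) + I‖ ^ 2)) := by gcongr
    refine e.trans (le_of_eq ?_)
    field_simp

end HeckeKernel

/-! ### Hecke's trick: row sums compared with row integrals. -/

section HeckeSum

open Complex MeasureTheory
open scoped Real

/-- The lattice points `m τ + n` with `m ≥ 1`, indexed by `(m - 1, n)`. -/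
noncomputable def latticePt (τ : ℂ) (p : ℕ × ℤ) : ℂ := ((p.1 : ℂ) + 1) * τ + p.2

/-- The term `ω⁻² |ω|⁻ˢ` of Hecke's series. -/
noncomputable def heckeTerm (s : ℝ) (ω : ℂ) : ℂ := 1 / (ω ^ 2 * ((‖ω‖ ^ s : ℝ) : ℂ))

/-- The term of Hecke's series at the point `x + y i`. -/
noncomputable def rowKernel (s y x : ℝ) : ℂ := ((y ^ (-2 - s) : ℝ) : ℂ) * heckeKernel s (x / y)

variable {τ : ℂ}

lemma ofReal_add_mul_I_eq {y : ℝ} (hy : 0 < y) (x : ℝ) :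
    (x : ℂ) + y * I = y * ((x / y : ℝ) + I) := by
  have : (y : ℂ) ≠ 0 := by exact_mod_cast hy.ne'
  push_cast
  field_simp

lemma norm_ofReal_add_I_rpow (s u : ℝ) : ‖(u : ℂ) + I‖ ^ s = (1 + u ^ 2) ^ (s / 2) := by
  rw [← norm_ofReal_add_I_sq, ← Real.rpow_natCast, ← Real.rpow_mul (norm_nonneg _)]
  congr 1
  push_cast
  ring

lemma heckeTerm_eq_rowKernel {y : ℝ} (hy : 0 < y) (s x : ℝ) :
    heckeTerm s (x + y * I) = rowKernel s y x := by
  have hy' : (y : ℂ) ≠ 0 := by exact_mod_cast hy.ne'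
  have h0 := ofReal_add_I_ne_zero (x / y)
  have hq : 0 < 1 + (x / y) ^ 2 := by positivity
  rw [heckeTerm, rowKernel, heckeKernel, ofReal_add_mul_I_eq hy, norm_mul, Complex.norm_real,
    Real.norm_of_nonneg hy.le, Real.mul_rpow hy.le (norm_nonneg _), norm_ofReal_add_I_rpow, neg_div,
    Real.rpow_neg hq.le, Real.rpow_sub hy, Real.rpow_neg hy.le, Real.rpow_two]
  push_cast
  field_simp

lemma continuous_rowKernel (s y : ℝ) : Continuous (rowKernel s y) := by
  have := (continuous_heckeKernel s).comp (continuous_id.div_const y)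
  exact continuous_const.mul this

lemma hasSum_intervalIntegral_rowKernel {s y : ℝ} (hs : 0 ≤ s) (hy : 0 < y) (c : ℝ) :
    HasSum (fun n : ℤ ↦ ∫ x in (n : ℝ)..n + 1, rowKernel s y (x + c))
      (((y ^ (-1 - s) : ℝ) : ℂ) * ∫ u, heckeKernel s u) := by
  have h1 : Integrable fun x ↦ rowKernel s y (x + c) :=
    (((integrable_heckeKernel hs).comp_div hy.ne').const_mul _).comp_add_right c
  have h2 := h1.hasSum_intervalIntegral 0
  simp only [zero_add] at h2
  have e : ∫ x, rowKernel s y (x + c)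
      = ((y ^ (-1 - s) : ℝ) : ℂ) * ∫ u, heckeKernel s u := by
    rw [integral_add_right_eq_self (rowKernel s y) c]
    simp only [rowKernel]
    rw [integral_const_mul, Measure.integral_comp_div, abs_of_pos hy, real_smul, ← mul_assoc,
      show (-1 - s : ℝ) = (-2 - s) + 1 by ring, Real.rpow_add_one hy.ne']
    push_cast
    rfl
  rw [← e]
  exact h2

lemma exists_hasDerivAt_rowKernel {s y : ℝ} (hs : 0 ≤ s) (hy : 0 < y) (x : ℝ) :
    ∃ d : ℂ, HasDerivAt (rowKernel s y) d x
      ∧ ‖d‖ ≤ (2 + s) * y ^ (-s) * (‖(x : ℂ) + y * I‖ ^ 3)⁻¹ := by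
  obtain ⟨d, hd, hle⟩ := exists_hasDerivAt_heckeKernel hs (x / y)
  refine ⟨_, (hd.scomp x ((hasDerivAt_id x).div_const y)).const_mul _, ?_⟩
  rw [ofReal_add_mul_I_eq hy, norm_mul, norm_smul, norm_mul, Complex.norm_real, Complex.norm_real,
    Real.norm_of_nonneg hy.le, Real.norm_of_nonneg (by positivity), Real.norm_of_nonneg
    (by positivity), show (-2 - s : ℝ) = -s - 2 by ring, Real.rpow_sub hy, Real.rpow_two]
  calc _ ≤ y ^ (-s) / y ^ 2 * (1 / y * ((2 + s) * (‖((x / y : ℝ) : ℂ) + I‖ ^ 3)⁻¹)) := by gcongr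
    _ = _ := by
      have : ‖((x / y : ℝ) : ℂ) + I‖ ≠ 0 := norm_ne_zero_iff.mpr (ofReal_add_I_ne_zero _)
      field_simp

lemma le_norm_ofReal_add_mul_I {y : ℝ} (hy : 0 < y) (x : ℝ) : y ≤ ‖(x : ℂ) + y * I‖ := by
  have := Complex.abs_im_le_norm ((x : ℂ) + y * I)
  simpa [abs_of_pos hy] using this

/-- Mean value inequality. A unit shift changes `|x + iy|` by a factor at most `1 + 1/b`, which
enters cubed; the fourth power comes from `y⁻ˢ ≤ 1 + 1/b`, and `3` bounds `2 + s`. The constant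
depends neither on the row nor on `s`. -/
lemma norm_rowKernel_sub_le {s y b : ℝ} (hs : 0 ≤ s) (hs1 : s ≤ 1) (hb : 0 < b) (hby : b ≤ y)
    {x₀ x : ℝ} (hx : |x - x₀| ≤ 1) :
    ‖rowKernel s y x - rowKernel s y x₀‖
      ≤ 3 * (1 + 1 / b) ^ 4 * (‖(x₀ : ℂ) + y * I‖ ^ 3)⁻¹ := by
  have hy : 0 < y := hb.trans_le hby
  choose d hd hle using exists_hasDerivAt_rowKernel hs hy
  have hK : y ^ (-s) ≤ 1 + 1 / b := by
    have h1 : (1 : ℝ) ≤ 1 + 1 / b := by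
      have : 0 < 1 / b := by positivity
      linarith
    calc y ^ (-s) ≤ b ^ (-s) := Real.rpow_le_rpow_of_nonpos hb hby (by linarith)
      _ = (1 / b) ^ s := by rw [one_div, Real.inv_rpow hb.le, Real.rpow_neg hb.le]
      _ ≤ (1 + 1 / b) ^ s := Real.rpow_le_rpow (by positivity) (by linarith) hs
      _ ≤ (1 + 1 / b) ^ (1 : ℝ) := Real.rpow_le_rpow_of_exponent_le h1 hs1
      _ = _ := Real.rpow_one _
  have hbound : ∀ v ∈ Metric.closedBall x₀ 1,
      ‖d v‖ ≤ 3 * (1 + 1 / b) ^ 4 * (‖(x₀ : ℂ) + y * I‖ ^ 3)⁻¹ := by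
    intro v hv
    rw [Metric.mem_closedBall, Real.dist_eq] at hv
    have hyv := le_norm_ofReal_add_mul_I hy v
    have hpos : 0 < ‖(v : ℂ) + y * I‖ := hy.trans_le hyv
    have hpos0 : 0 < ‖(x₀ : ℂ) + y * I‖ := hy.trans_le (le_norm_ofReal_add_mul_I hy x₀)
    have h1 : ‖(x₀ : ℂ) + y * I‖ ≤ (1 + 1 / b) * ‖(v : ℂ) + y * I‖ := by
      have e : (x₀ : ℂ) + y * I = (v + y * I) - ((v - x₀ : ℝ) : ℂ) := by push_cast; ring
      have h2 : ‖(x₀ : ℂ) + y * I‖ ≤ ‖(v : ℂ) + y * I‖ + 1 := by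
        rw [e]
        refine (norm_sub_le _ _).trans (add_le_add le_rfl ?_)
        rwa [Complex.norm_real, Real.norm_eq_abs]
      have h3 : 1 ≤ 1 / b * ‖(v : ℂ) + y * I‖ := by
        rw [one_div, ← div_eq_inv_mul, one_le_div hb]
        linarith
      linarith
    have h4 : (‖(v : ℂ) + y * I‖ ^ 3)⁻¹ ≤ (1 + 1 / b) ^ 3 * (‖(x₀ : ℂ) + y * I‖ ^ 3)⁻¹ := by
      rw [← div_eq_mul_inv, le_div_iff₀ (by positivity), ← div_eq_inv_mul,
        div_le_iff₀ (by positivity), ← mul_pow]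
      gcongr
    calc ‖d v‖ ≤ (2 + s) * y ^ (-s) * (‖(v : ℂ) + y * I‖ ^ 3)⁻¹ := hle v
      _ ≤ 3 * (1 + 1 / b) * ((1 + 1 / b) ^ 3 * (‖(x₀ : ℂ) + y * I‖ ^ 3)⁻¹) := by
        gcongr
        linarith
      _ = _ := by ring
  have h := (convex_closedBall x₀ 1).norm_image_sub_le_of_norm_hasDerivWithin_le
    (fun v _ ↦ (hd v).hasDerivWithinAt) hbound (Metric.mem_closedBall_self zero_le_one)
    (by rwa [Metric.mem_closedBall, Real.dist_eq])
  refine h.trans (mul_le_of_le_one_right (by positivity) ?_)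
  rwa [Real.norm_eq_abs]

lemma latticePt_eq (τ : ℂ) (p : ℕ × ℤ) : latticePt τ p
    = ((p.2 + (p.1 + 1) * τ.re : ℝ) : ℂ) + (((p.1 + 1) * τ.im : ℝ) : ℂ) * I := by
  rw [latticePt]
  nth_rewrite 1 [← Complex.re_add_im τ]
  push_cast
  ring

/-- The difference between a term of Hecke's series and the integral of the summand over the
adjacent unit interval in the same row. -/
noncomputable def heckeError (τ : ℂ) (s : ℝ) (p : ℕ × ℤ) : ℂ :=
  heckeTerm s (latticePt τ p)
    - ∫ x in (p.2 : ℝ)..p.2 + 1, rowKernel s ((p.1 + 1) * τ.im) (x + (p.1 + 1) * τ.re)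

lemma row_height_pos (hτ : 0 < τ.im) (M : ℕ) : 0 < ((M : ℝ) + 1) * τ.im := by positivity

lemma im_le_row_height (hτ : 0 < τ.im) (M : ℕ) : τ.im ≤ ((M : ℝ) + 1) * τ.im :=
  le_mul_of_one_le_left hτ.le (by linarith [Nat.cast_nonneg (α := ℝ) M])

lemma norm_heckeError_le (hτ : 0 < τ.im) {s : ℝ} (hs : 0 ≤ s) (hs1 : s ≤ 1) (p : ℕ × ℤ) :
    ‖heckeError τ s p‖ ≤ 3 * (1 + 1 / τ.im) ^ 4 * (‖latticePt τ p‖ ^ 3)⁻¹ := by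
  have hy := row_height_pos hτ p.1
  have hi : IntervalIntegrable (fun x ↦ rowKernel s ((p.1 + 1) * τ.im) (x + (p.1 + 1) * τ.re))
      volume p.2 (p.2 + 1) :=
    ((continuous_rowKernel _ _).comp (continuous_add_const _)).intervalIntegrable _ _
  have h : heckeError τ s p = ∫ x in (p.2 : ℝ)..p.2 + 1,
      (rowKernel s ((p.1 + 1) * τ.im) (p.2 + (p.1 + 1) * τ.re)
        - rowKernel s ((p.1 + 1) * τ.im) (x + (p.1 + 1) * τ.re)) := by
    rw [intervalIntegral.integral_sub intervalIntegrable_const hi, intervalIntegral.integral_const,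
      heckeError, latticePt_eq, heckeTerm_eq_rowKernel hy]
    simp
  have h2 : ∀ x ∈ Set.uIoc (p.2 : ℝ) (p.2 + 1),
      ‖rowKernel s ((p.1 + 1) * τ.im) (p.2 + (p.1 + 1) * τ.re)
        - rowKernel s ((p.1 + 1) * τ.im) (x + (p.1 + 1) * τ.re)‖
      ≤ 3 * (1 + 1 / τ.im) ^ 4 * (‖latticePt τ p‖ ^ 3)⁻¹ := by
    intro x hx
    rw [norm_sub_rev, latticePt_eq]
    refine norm_rowKernel_sub_le hs hs1 hτ (im_le_row_height hτ p.1) ?_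
    rw [Set.uIoc_of_le (by linarith)] at hx
    rw [abs_le]
    constructor <;> linarith [hx.1, hx.2]
  have h3 := intervalIntegral.norm_integral_le_of_norm_le_const h2
  rw [add_sub_cancel_left, abs_one, mul_one] at h3
  rw [h]
  exact h3

lemma latticePt_ne_zero (hτ : 0 < τ.im) (p : ℕ × ℤ) : latticePt τ p ≠ 0 := by
  intro h
  have := congrArg Complex.im h
  rw [latticePt_eq] at this
  have h0 := row_height_pos hτ p.1
  simp at this
  rcases this with h | h
  · linarith [Nat.cast_nonneg (α := ℝ) p.1]
  · exact hτ.ne' h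

lemma summable_norm_latticePt_rpow (hτ : 0 < τ.im) {k : ℝ} (hk : 2 < k) :
    Summable fun p : ℕ × ℤ ↦ ‖latticePt τ p‖ ^ (-k) := by
  have hinj : Function.Injective fun p : ℕ × ℤ ↦ (![(p.1 : ℤ) + 1, p.2] : Fin 2 → ℤ) := by
    intro p p' h
    have h0 := congrFun h 0
    have h1 := congrFun h 1
    simp at h0 h1
    exact Prod.ext h0 h1
  have hs := ((EisensteinSeries.summable_one_div_norm_rpow hk).comp_injective hinj).mul_left
    (EisensteinSeries.r ⟨τ, hτ⟩ ^ (-k))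
  refine hs.of_nonneg_of_le (fun p ↦ by positivity) fun p ↦ ?_
  have := EisensteinSeries.summand_bound ⟨τ, hτ⟩ (k := k) (by linarith) ![(p.1 : ℤ) + 1, p.2]
  simpa [latticePt] using this

lemma norm_heckeTerm (s : ℝ) {ω : ℂ} (hω : ω ≠ 0) : ‖heckeTerm s ω‖ = ‖ω‖ ^ (-(2 + s)) := by
  have h := norm_pos_iff.mpr hω
  rw [heckeTerm, norm_div, norm_one, norm_mul, norm_pow, Complex.norm_real,
    Real.norm_of_nonneg (by positivity), Real.rpow_neg h.le, Real.rpow_add h, Real.rpow_two,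
    one_div]

lemma summable_heckeTerm (hτ : 0 < τ.im) {s : ℝ} (hs : 0 < s) :
    Summable fun p : ℕ × ℤ ↦ heckeTerm s (latticePt τ p) := by
  refine Summable.of_norm ?_
  simp_rw [fun p ↦ norm_heckeTerm s (latticePt_ne_zero hτ p)]
  exact summable_norm_latticePt_rpow hτ (by linarith)

lemma summable_heckeError_bound (hτ : 0 < τ.im) :
    Summable fun p : ℕ × ℤ ↦ 3 * (1 + 1 / τ.im) ^ 4 * (‖latticePt τ p‖ ^ 3)⁻¹ := by
  refine Summable.mul_left _ ((summable_norm_latticePt_rpow hτ (k := 3) (by norm_num)).congr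
    fun p ↦ ?_)
  rw [Real.rpow_neg (norm_nonneg _)]
  norm_cast

lemma summable_heckeError (hτ : 0 < τ.im) {s : ℝ} (hs : 0 ≤ s) (hs1 : s ≤ 1) :
    Summable (heckeError τ s) :=
  (summable_heckeError_bound hτ).of_norm_bounded (norm_heckeError_le hτ hs hs1)

lemma continuous_heckeTerm {ω : ℂ} (hω : ω ≠ 0) : Continuous fun s ↦ heckeTerm s ω := by
  have h := norm_pos_iff.mpr hω
  have h1 : Continuous fun s : ℝ ↦ ‖ω‖ ^ s :=
    continuous_const.rpow continuous_id fun _ ↦ Or.inl h.ne'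
  unfold heckeTerm
  refine continuous_const.div (continuous_const.mul (continuous_ofReal.comp h1)) fun s ↦ ?_
  exact mul_ne_zero (pow_ne_zero 2 hω) (by exact_mod_cast (Real.rpow_pos_of_pos h s).ne')

lemma continuous_heckeError (hτ : 0 < τ.im) (p : ℕ × ℤ) :
    Continuous fun s ↦ heckeError τ s p := by
  have hy := row_height_pos hτ p.1
  simp only [heckeError]
  refine (continuous_heckeTerm (latticePt_ne_zero hτ p)).sub ?_
  refine intervalIntegral.continuous_parametric_intervalIntegral_of_continuous'
    (f := fun s x ↦ rowKernel s ((p.1 + 1) * τ.im) (x + (p.1 + 1) * τ.re)) ?_ _ _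
  have h1 : Continuous fun x : ℝ × ℝ ↦ ((((p.1 + 1) * τ.im) ^ (-2 - x.1) : ℝ) : ℂ) :=
    continuous_ofReal.comp
      (continuous_const.rpow (by fun_prop) fun _ ↦ Or.inl hy.ne')
  have h2 : Continuous fun x : ℝ × ℝ ↦
      heckeKernel x.1 ((x.2 + (p.1 + 1) * τ.re) / ((p.1 + 1) * τ.im)) :=
    continuous_heckeKernel_comp continuous_fst
      ((continuous_snd.add continuous_const).div_const _)
  refine (h1.mul h2).congr fun x ↦ ?_
  rw [Pi.mul_apply, Function.uncurry, rowKernel]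

lemma tendsto_tsum_heckeError (hτ : 0 < τ.im) :
    Tendsto (fun s ↦ ∑' p, heckeError τ s p) (𝓝[>] 0) (𝓝 (∑' p, heckeError τ 0 p)) := by
  refine tendsto_tsum_of_dominated_convergence (summable_heckeError_bound hτ) (fun p ↦
    ((continuous_heckeError hτ p).tendsto 0).mono_left nhdsWithin_le_nhds) ?_
  filter_upwards [Ioc_mem_nhdsGT (zero_lt_one' ℝ)] with s hs p
  exact norm_heckeError_le hτ hs.1.le hs.2 p

lemma summable_row (hτ : 0 < τ.im) (M : ℕ) :
    Summable fun n : ℤ ↦ heckeTerm 0 (latticePt τ (M, n)) := by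
  have h1 := hasSum_intervalIntegral_rowKernel le_rfl (row_height_pos hτ M)
    ((M + 1) * τ.re) (s := 0)
  have h2 : Summable fun n : ℤ ↦ heckeError τ 0 (M, n) :=
    (summable_heckeError hτ le_rfl zero_le_one).comp_injective (Prod.mk_right_injective M)
  simpa [heckeError] using h2.add h1.summable

/-- The sum of `(m τ + n)⁻²` over `m ≥ 1` and `n`, in Eisenstein's order of summation. -/
lemma hasSum_row_sums (hτ : 0 < τ.im) :
    HasSum (fun M : ℕ ↦ ∑' n : ℤ, heckeTerm 0 (latticePt τ (M, n)))
      (∑' p, heckeError τ 0 p) := by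
  refine (summable_heckeError hτ le_rfl zero_le_one).hasSum.prod_fiberwise fun M ↦ ?_
  have h1 := hasSum_intervalIntegral_rowKernel le_rfl (row_height_pos hτ M)
    ((M + 1) * τ.re) (s := 0)
  -- At `s = 0` the full row integral is zero, so a row of errors has the same sum as the row
  -- itself.
  rw [integral_heckeKernel le_rfl, ofReal_zero, neg_zero, zero_mul, mul_zero] at h1
  have h2 := (summable_row hτ M).hasSum.sub h1
  rw [sub_zero] at h2
  exact h2

/-- The difference is the sum of the row integrals. By scaling, the row of height `y` contributes
`y^(-1-s)` times a fixed integral, and summing over heights produces `ζ(1+s)`. -/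
lemma tsum_heckeTerm_sub_tsum_heckeError (hτ : 0 < τ.im) {s : ℝ} (hs : 0 < s) (hs1 : s ≤ 1) :
    ∑' p, heckeTerm s (latticePt τ p) - ∑' p, heckeError τ s p
      = -((τ.im ^ (-1 - s) : ℝ) : ℂ) * ((s * ∑' n : ℕ, 1 / (n : ℝ) ^ (1 + s) : ℝ) : ℂ)
        * ∫ u, heckeKernelAux s u := by
  have h1 := (summable_heckeTerm hτ hs).hasSum.sub (summable_heckeError hτ hs.le hs1).hasSum
  have h2 := h1.prod_fiberwise (g := fun M : ℕ ↦
      (((((M : ℝ) + 1) * τ.im) ^ (-1 - s) : ℝ) : ℂ) * ∫ u, heckeKernel s u) fun M ↦ by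
    refine (hasSum_intervalIntegral_rowKernel hs.le (row_height_pos hτ M)
      ((M + 1) * τ.re)).congr_fun fun n ↦ ?_
    simp [heckeError]
  rw [← h2.tsum_eq, integral_heckeKernel hs.le, tsum_mul_right]
  have h3 : ∀ M : ℕ, (((M : ℝ) + 1) * τ.im) ^ (-1 - s)
      = τ.im ^ (-1 - s) * (1 / (((M + 1 : ℕ) : ℝ)) ^ (1 + s)) := by
    intro M
    rw [Real.mul_rpow (by positivity) hτ.le, show (-1 - s) = -(1 + s) by ring,
      Real.rpow_neg (by positivity) (1 + s), mul_comm]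
    push_cast
    rw [one_div]
  -- The term `n = 0` is zero by the conventions for `0 ^ (1 + s)` and division by zero.
  have h4 : ∑' n : ℕ, 1 / (n : ℝ) ^ (1 + s) = ∑' n : ℕ, 1 / (((n + 1 : ℕ) : ℝ)) ^ (1 + s) := by
    rw [(Real.summable_one_div_nat_rpow.mpr (by linarith)).tsum_eq_zero_add]
    rw [Nat.cast_zero, Real.zero_rpow (by linarith), div_zero, zero_add]
  rw [← ofReal_tsum]
  simp_rw [h3]
  rw [tsum_mul_left, h4]
  push_cast
  ring

/-- **Hecke's trick**: the limit of `∑ ω⁻² |ω|⁻ˢ` over the lattice points `ω = m τ + n` with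
`m ≥ 1` as `s → 0⁺`. -/
theorem tendsto_tsum_heckeTerm (hτ : 0 < τ.im) :
    Tendsto (fun s ↦ ∑' p, heckeTerm s (latticePt τ p)) (𝓝[>] 0)
      (𝓝 (∑' p, heckeError τ 0 p - π / (2 * τ.im))) := by
  -- The residue of zeta at `1`.
  have h1 : Tendsto (fun s : ℝ ↦ s * ∑' n : ℕ, 1 / (n : ℝ) ^ (1 + s)) (𝓝[>] 0) (𝓝 1) := by
    have ht : Tendsto (fun s : ℝ ↦ 1 + s) (𝓝[>] 0) (𝓝[>] 1) := by
      refine tendsto_nhdsWithin_iff.mpr ⟨?_, ?_⟩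
      · exact (Continuous.tendsto' (by fun_prop) _ _ (by norm_num)).mono_left nhdsWithin_le_nhds
      · filter_upwards [self_mem_nhdsWithin] with s hs
        simpa using hs
    refine (tendsto_sub_mul_tsum_nat_rpow.comp ht).congr fun s ↦ ?_
    simp
  have h2 : Tendsto (fun s : ℝ ↦ τ.im ^ (-1 - s)) (𝓝[>] 0) (𝓝 (τ.im ^ (-1 - (0 : ℝ)))) :=
    (Continuous.tendsto (continuous_const.rpow (by fun_prop) fun _ ↦ Or.inl hτ.ne')
      0).mono_left nhdsWithin_le_nhds
  have h3 := (tendsto_tsum_heckeError hτ).add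
    (((((continuous_ofReal.tendsto _).comp h2).neg).mul
      ((continuous_ofReal.tendsto _).comp h1)).mul tendsto_integral_heckeKernelAux)
  have e : ∑' p, heckeError τ 0 p + -((τ.im ^ (-1 - (0 : ℝ)) : ℝ) : ℂ) * ((1 : ℝ) : ℂ) * (π / 2)
      = ∑' p, heckeError τ 0 p - π / (2 * τ.im) := by
    rw [sub_zero, Real.rpow_neg_one]
    have : (τ.im : ℂ) ≠ 0 := by exact_mod_cast hτ.ne'
    push_cast
    field_simp
    ring
  rw [e] at h3
  refine h3.congr' ?_
  filter_upwards [Ioc_mem_nhdsGT (zero_lt_one' ℝ)] with s hs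
  simp only [Function.comp_apply]
  rw [← tsum_heckeTerm_sub_tsum_heckeError hτ hs.1 hs.2]
  ring

end HeckeSum

/-! ### Primitive points, their multiples, and the parametrization of `Xset`. -/

section PrimitivePoints

open Complex

/-- Indices of the primitive lattice points `m τ + n` with `m ≥ 1`. -/
abbrev PrimIndex : Type := {p : ℕ × ℤ // Int.gcd ((p.1 : ℤ) + 1) p.2 = 1}

/-- The lattice points with `m ≥ 1` are the positive multiples of the primitive ones. -/
def primMul (x : PrimIndex × ℕ) : ℕ × ℤ :=
  ((x.2 + 1) * (x.1.1.1 + 1) - 1, (x.2 + 1) * x.1.1.2)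

/-- The first coordinate stores `m - 1`; truncated subtraction is harmless because the product is
positive. -/
lemma primMul_fst_add_one (x : PrimIndex × ℕ) :
    (primMul x).1 + 1 = (x.2 + 1) * (x.1.1.1 + 1) :=
  Nat.sub_add_cancel (Nat.succ_le_of_lt (by positivity))

lemma gcd_primMul (x : PrimIndex × ℕ) :
    Int.gcd (((primMul x).1 : ℤ) + 1) (primMul x).2 = x.2 + 1 := by
  have h : ((primMul x).1 : ℤ) + 1 = ((x.2 + 1 : ℕ) : ℤ) * ((x.1.1.1 : ℤ) + 1) := by
    exact_mod_cast primMul_fst_add_one x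
  have h2 : (primMul x).2 = ((x.2 + 1 : ℕ) : ℤ) * x.1.1.2 := by simp [primMul]
  rw [h, h2, Int.gcd_mul_left, x.1.2, mul_one, Int.natAbs_natCast]

/-- The multiplier is recovered as the gcd of the coordinates, and dividing by the gcd gives the
primitive point. -/
lemma primMul_bijective : Function.Bijective primMul := by
  constructor
  · intro x y hxy
    have hk : x.2 = y.2 := by
      have hx := gcd_primMul x
      rw [hxy, gcd_primMul y] at hx
      omega
    have h1 := primMul_fst_add_one x
    rw [hxy, primMul_fst_add_one y, hk] at h1
    have h1' := Nat.eq_of_mul_eq_mul_left (Nat.succ_pos _) h1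
    have h2 : (primMul x).2 = (primMul y).2 := by rw [hxy]
    simp only [primMul, hk] at h2
    have h2' := mul_left_cancel₀ (by positivity : ((y.2 : ℤ) + 1) ≠ 0) h2
    exact Prod.ext (Subtype.ext (Prod.ext (by omega) h2')) hk
  · rintro ⟨M, n⟩
    have hg : 0 < Int.gcd ((M : ℤ) + 1) n := Int.gcd_pos_of_ne_zero_left _ (by positivity)
    obtain ⟨g, hg'⟩ : ∃ g, Int.gcd ((M : ℤ) + 1) n = g + 1 := ⟨_, (Nat.succ_pred_eq_of_pos hg).symm⟩
    obtain ⟨m', hm'⟩ := Int.gcd_dvd_left (a := (M : ℤ) + 1) (b := n)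
    obtain ⟨n', hn'⟩ := Int.gcd_dvd_right (a := (M : ℤ) + 1) (b := n)
    rw [hg'] at hm' hn'
    push_cast at hm' hn'
    have hpos : 0 < m' := by
      by_contra h
      have : ((g : ℤ) + 1) * m' ≤ 0 := mul_nonpos_of_nonneg_of_nonpos (by positivity) (by omega)
      omega
    obtain ⟨M', rfl⟩ : ∃ M' : ℕ, m' = M' + 1 := ⟨(m' - 1).toNat, by omega⟩
    have hc : Int.gcd ((M' : ℤ) + 1) n' = 1 := by
      have h := hg'
      rw [hm', hn', Int.gcd_mul_left] at h
      have e : ((g : ℤ) + 1).natAbs = g + 1 := by omega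
      rw [e] at h
      exact Nat.eq_of_mul_eq_mul_left (Nat.succ_pos g) (by rw [h, mul_one])
    refine ⟨(⟨(M', n'), hc⟩, g), Prod.ext ?_ ?_⟩
    · have h := primMul_fst_add_one (⟨(M', n'), hc⟩, g)
      have h' : M + 1 = (g + 1) * (M' + 1) := by exact_mod_cast hm'
      exact Nat.succ_injective (h.trans h'.symm)
    · exact hn'.symm

/-- Every lattice point with `m ≥ 1` is a unique positive multiple of a primitive one. -/
noncomputable def primEquiv : PrimIndex × ℕ ≃ ℕ × ℤ := Equiv.ofBijective primMul primMul_bijective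

lemma latticePt_primEquiv (τ : ℂ) (c : PrimIndex) (k : ℕ) :
    latticePt τ (primEquiv (c, k)) = ((k : ℂ) + 1) * latticePt τ c := by
  have h : (((primMul (c, k)).1 : ℂ) + 1) = ((k : ℂ) + 1) * ((c.1.1 : ℂ) + 1) := by
    exact_mod_cast primMul_fst_add_one (c, k)
  rw [primEquiv, Equiv.ofBijective_apply, latticePt, latticePt, h]
  simp only [primMul]
  push_cast
  ring

lemma heckeTerm_neg (s : ℝ) (ω : ℂ) : heckeTerm s (-ω) = heckeTerm s ω := by
  rw [heckeTerm, heckeTerm, neg_sq, norm_neg]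

/-- Norms determine `|ω|`, since the exponent `2 + s` is nonzero; then the squares agree. Hence
elements of the set correspond exactly to primitive points modulo sign. -/
lemma eq_or_eq_neg_of_heckeTerm_eq {s : ℝ} (hs : 0 ≤ s) {ω ω' : ℂ} (hω : ω ≠ 0) (hω' : ω' ≠ 0)
    (h : heckeTerm s ω = heckeTerm s ω') : ω = ω' ∨ ω = -ω' := by
  have h1 : ‖ω‖ = ‖ω'‖ := by
    have h2 := congrArg norm h
    rw [norm_heckeTerm s hω, norm_heckeTerm s hω'] at h2
    exact (Real.rpow_left_inj (norm_nonneg _) (norm_nonneg _) (by linarith)).mp h2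
  have h3 : ((‖ω'‖ ^ s : ℝ) : ℂ) ≠ 0 := by
    exact_mod_cast (Real.rpow_pos_of_pos (norm_pos_iff.mpr hω') s).ne'
  rw [heckeTerm, heckeTerm, h1, div_eq_div_iff (mul_ne_zero (pow_ne_zero 2 hω) h3)
    (mul_ne_zero (pow_ne_zero 2 hω') h3), one_mul, one_mul] at h
  exact sq_eq_sq_iff_eq_or_eq_neg.mp (mul_right_cancel₀ h3 h).symm

/-- Representatives modulo sign of the primitive lattice points: those with `m ≥ 1`, and `1`. -/
noncomputable def primPt (τ : ℂ) : PrimIndex ⊕ Unit → ℂ :=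
  Sum.elim (fun c ↦ latticePt τ c) (fun _ ↦ 1)

variable {τ : ℂ}

lemma latticePt_im (τ : ℂ) (p : ℕ × ℤ) : (latticePt τ p).im = (p.1 + 1) * τ.im := by
  rw [latticePt_eq]
  simp

lemma latticePt_injective (hτ : 0 < τ.im) : Function.Injective (latticePt τ) := by
  intro p p' h
  have h1 := congrArg Complex.im h
  rw [latticePt_im, latticePt_im] at h1
  have h2 : (p.1 : ℝ) = p'.1 := by
    have := mul_right_cancel₀ hτ.ne' h1
    linarith
  have h3 : p.1 = p'.1 := by exact_mod_cast h2
  rw [latticePt, latticePt, h3] at h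
  exact Prod.ext h3 (by exact_mod_cast add_left_cancel h)

lemma primPt_ne_zero (hτ : 0 < τ.im) (i : PrimIndex ⊕ Unit) : primPt τ i ≠ 0 := by
  rcases i with c | _
  · exact latticePt_ne_zero hτ c
  · exact one_ne_zero

lemma primPt_eq_of_eq_or_eq_neg (hτ : 0 < τ.im) {i j : PrimIndex ⊕ Unit}
    (h : primPt τ i = primPt τ j ∨ primPt τ i = -primPt τ j) : i = j := by
  have him : ∀ c : PrimIndex, 0 < (latticePt τ c).im := fun c ↦ by
    rw [latticePt_im]
    exact row_height_pos hτ _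
  rcases i with c | _ <;> rcases j with d | _
  · rcases h with h | h
    · exact congrArg Sum.inl (Subtype.ext (latticePt_injective hτ h))
    · have h1 := congrArg Complex.im h
      simp only [primPt, Sum.elim_inl, neg_im] at h1
      linarith [him c, him d]
  · rcases h with h | h <;>
    · have h1 := congrArg Complex.im h
      simp [primPt] at h1
      linarith [him c]
  · rcases h with h | h <;>
    · have h1 := congrArg Complex.im h
      simp [primPt] at h1
      linarith [him d]
  · rfl

lemma heckeTerm_primPt_injective (hτ : 0 < τ.im) {s : ℝ} (hs : 0 ≤ s) :
    Function.Injective fun i ↦ heckeTerm s (primPt τ i) := fun _ _ h ↦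
  primPt_eq_of_eq_or_eq_neg hτ
    (eq_or_eq_neg_of_heckeTerm_eq hs (primPt_ne_zero hτ _) (primPt_ne_zero hτ _) h)

lemma range_heckeTerm_primPt (τ : ℂ) (s : ℝ) :
    Set.range (fun i ↦ heckeTerm s (primPt τ i)) = Xset τ s := by
  have key : ∀ m n : ℤ, 0 < m → Int.gcd m n = 1 →
      heckeTerm s (m * τ + n) ∈ Set.range fun i ↦ heckeTerm s (primPt τ i) := by
    intro m n hm h
    obtain ⟨M, rfl⟩ : ∃ M : ℕ, m = M + 1 := ⟨(m - 1).toNat, by omega⟩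
    refine ⟨Sum.inl ⟨(M, n), h⟩, ?_⟩
    simp [primPt, latticePt]
  ext x
  constructor
  · rintro ⟨c | u, rfl⟩
    · exact ⟨c.1.1 + 1, c.1.2, c.2, by simp [primPt, latticePt, heckeTerm]⟩
    · exact ⟨0, 1, by simp, by simp [primPt, heckeTerm]⟩
  · rintro ⟨m, n, h, rfl⟩
    change heckeTerm s (m * τ + n) ∈ _
    rcases lt_trichotomy m 0 with hm | rfl | hm
    · rw [← heckeTerm_neg]
      have := key (-m) (-n) (by omega) (by simpa using h)
      push_cast at this
      rwa [neg_mul, ← neg_add] at this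
    · have hn : n.natAbs = 1 := by simpa using h
      refine ⟨Sum.inr (), ?_⟩
      rcases Int.natAbs_eq n with h' | h' <;> rw [h', hn]
      · simp [primPt]
      · simp [primPt, heckeTerm_neg]
    · exact key m n hm h

/-- The elements of `X_τ(s)` are indexed by the primitive lattice points modulo sign. -/
noncomputable def XsetEquiv (hτ : 0 < τ.im) {s : ℝ} (hs : 0 ≤ s) :
    PrimIndex ⊕ Unit ≃ Xset τ s :=
  (Equiv.ofInjective _ (heckeTerm_primPt_injective hτ hs)).trans
    (Equiv.setCongr (range_heckeTerm_primPt τ s))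

lemma coe_XsetEquiv (hτ : 0 < τ.im) {s : ℝ} (hs : 0 ≤ s) (i : PrimIndex ⊕ Unit) :
    (XsetEquiv hτ hs i : ℂ) = heckeTerm s (primPt τ i) := rfl

lemma hasProd_Xset (hτ : 0 < τ.im) {s : ℝ} (hs : 0 ≤ s) {f : ℂ → ℂ} {a : ℂ}
    (h : HasProd (fun c : PrimIndex ↦ f (heckeTerm s (latticePt τ c))) a) :
    HasProd (fun x : Xset τ s ↦ f x) (a * f 1) := by
  rw [← (XsetEquiv hτ hs).hasProd_iff]
  refine HasProd.sum (f := (fun x : Xset τ s ↦ f x) ∘ XsetEquiv hτ hs) h ?_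
  have : (fun _ : Unit ↦ f 1) = ((fun x : Xset τ s ↦ f x) ∘ XsetEquiv hτ hs) ∘ Sum.inr := by
    funext u
    simp [coe_XsetEquiv, primPt, heckeTerm]
  rw [← this]
  exact hasProd_unique _

end PrimitivePoints

/-! ### The Weierstrass product over the lattice and the duplication of sinc. -/

section LatticeProducts

open Complex
open scoped Real

variable {τ : ℂ}

lemma heckeTerm_zero (ω : ℂ) : heckeTerm 0 ω = 1 / ω ^ 2 := by simp [heckeTerm]

lemma norm_one_sub_mul_exp_sub_one_le {v : ℂ} (hv : ‖v‖ ≤ 1) :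
    ‖(1 - v) * exp v - 1‖ ≤ 3 * ‖v‖ ^ 2 := by
  have h1 := norm_exp_sub_one_sub_le hv
  have e : (1 - v) * exp v - 1 = -v ^ 2 + (1 - v) * (exp v - (1 + v)) := by ring
  rw [e]
  have h2 : ‖1 - v‖ ≤ 2 := (norm_sub_le _ _).trans (by rw [norm_one]; linarith)
  calc _ ≤ ‖v‖ ^ 2 + 2 * ‖v‖ ^ 2 := by
        refine (norm_add_le _ _).trans (add_le_add (by simp) ?_)
        rw [norm_mul]
        gcongr
    _ = _ := by ring

/-- The terms of the summable series of inverse cubes tend to zero along the cofinite filter. -/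
lemma eventually_le_norm_latticePt (hτ : 0 < τ.im) (R : ℝ) :
    ∀ᶠ p in cofinite, R ≤ ‖latticePt τ p‖ := by
  have h := (summable_norm_latticePt_rpow hτ (k := 3) (by norm_num)).tendsto_cofinite_zero
  have hpos : (0 : ℝ) < (max R 1) ^ (-3 : ℝ) := by positivity
  filter_upwards [h.eventually_lt_const hpos] with p hp
  have h0 := norm_pos_iff.mpr (latticePt_ne_zero hτ p)
  by_contra hlt
  have := Real.rpow_le_rpow_of_nonpos h0 ((not_le.mp hlt).le.trans (le_max_left R 1))
    (by norm_num : (-3 : ℝ) ≤ 0)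
  linarith

lemma norm_sq_div_le_one {z ω : ℂ} (h : ‖z‖ + 1 ≤ ‖ω‖) : ‖z ^ 2 / ω ^ 2‖ ≤ 1 := by
  rw [norm_div, norm_pow, norm_pow]
  have h0 := norm_nonneg z
  exact div_le_one_of_le₀ (by gcongr; linarith) (by positivity)

lemma summable_norm_latticePt_inv_pow_four (hτ : 0 < τ.im) :
    Summable fun p : ℕ × ℤ ↦ (‖latticePt τ p‖ ^ 4)⁻¹ :=
  (summable_norm_latticePt_rpow hτ (k := 4) (by norm_num)).congr fun p ↦ by
    rw [Real.rpow_neg (norm_nonneg _)]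
    norm_cast

/-- The Weierstrass product of `(1 - z²/ω²) exp (z²/ω²)` over the lattice points with `m ≥ 1`. -/
lemma hasProd_weierstrass (hτ : 0 < τ.im) (z : ℂ) :
    HasProd (fun p : ℕ × ℤ ↦ (1 - z ^ 2 / latticePt τ p ^ 2) * exp (z ^ 2 / latticePt τ p ^ 2))
      (thetaProd z τ * exp (z ^ 2 * ∑' p, heckeError τ 0 p)) := by
  have hm : Multipliable fun p : ℕ × ℤ ↦
      (1 - z ^ 2 / latticePt τ p ^ 2) * exp (z ^ 2 / latticePt τ p ^ 2) := by
    have hs : Summable fun p : ℕ × ℤ ↦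
        (1 - z ^ 2 / latticePt τ p ^ 2) * exp (z ^ 2 / latticePt τ p ^ 2) - 1 := by
      refine Summable.of_norm_bounded_eventually
        ((summable_norm_latticePt_inv_pow_four hτ).mul_left (3 * ‖z‖ ^ 4)) ?_
      filter_upwards [eventually_le_norm_latticePt hτ (‖z‖ + 1)] with p hp
      refine (norm_one_sub_mul_exp_sub_one_le (norm_sq_div_le_one hp)).trans (le_of_eq ?_)
      rw [norm_div, norm_pow, norm_pow, div_pow]
      ring
    simpa using multipliable_one_add_of_summable hs.norm
  have hrow : ∀ M : ℕ, HasProd (fun n : ℤ ↦ (1 - z ^ 2 / latticePt τ (M, n) ^ 2)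
      * exp (z ^ 2 / latticePt τ (M, n) ^ 2))
      (sin (π * ((M + 1) * τ + z)) * sin (π * ((M + 1) * τ - z)) / sin (π * ((M + 1) * τ)) ^ 2
        * exp (z ^ 2 * ∑' n : ℤ, heckeTerm 0 (latticePt τ (M, n)))) := by
    intro M
    have h1 := hasProd_one_sub_sq_div_add_int_sq (w := (M + 1) * τ)
      (fun n ↦ latticePt_ne_zero hτ (M, n)) z
    have h2 := ((summable_row hτ M).hasSum.mul_left (z ^ 2)).cexp
    refine (h1.mul h2).congr_fun fun n ↦ ?_
    simp only [Function.comp_apply, heckeTerm_zero]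
    rw [mul_one_div, latticePt]
  -- Absolute convergence permits evaluation by rows; the sine quotients multiply to `thetaProd` and
  -- the exponents add up to Eisenstein's sum.
  have h3 := hm.hasProd.prod_fiberwise hrow
  have h4 := (hasProd_thetaProd hτ z).mul (((hasSum_row_sums hτ).mul_left (z ^ 2)).cexp)
  have h5 := h3.unique h4
  rw [← h5]
  exact hm.hasProd

lemma hasSum_one_div_add_one_sq : HasSum (fun k : ℕ ↦ 1 / ((k : ℂ) + 1) ^ 2) ((π : ℂ) ^ 2 / 6) := by
  have h := (hasSum_nat_add_iff' 1).mpr hasSum_zeta_two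
  simp only [Finset.range_one, Finset.sum_singleton, Nat.cast_zero] at h
  norm_num at h
  have h' := Complex.hasSum_ofReal.mpr h
  push_cast at h'
  simpa using h'

/-- The factors of the Weierstrass product belonging to the multiples of a primitive point. -/
lemma hasProd_weierstrass_prim (hτ : 0 < τ.im) (z : ℂ) :
    HasProd (fun c : PrimIndex ↦ sincPi (z / latticePt τ c)
        * exp (z ^ 2 / latticePt τ c ^ 2 * (π ^ 2 / 6)))
      (thetaProd z τ * exp (z ^ 2 * ∑' p, heckeError τ 0 p)) := by
  refine (primEquiv.hasProd_iff.mpr (hasProd_weierstrass hτ z)).prod_fiberwise fun c ↦ ?_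
  refine ((hasProd_sincPi (z / latticePt τ c)).mul
    (hasSum_one_div_add_one_sq.mul_left (z ^ 2 / latticePt τ c ^ 2)).cexp).congr_fun fun k ↦ ?_
  have h0 := latticePt_ne_zero hτ c
  have hk : (k : ℂ) + 1 ≠ 0 := Nat.cast_add_one_ne_zero k
  simp only [Function.comp_apply, latticePt_primEquiv]
  congr 2
  · field_simp
  · field_simp

lemma QL_sq_pi_mul_I {y : ℂ} (hy : sin (π * y) ≠ 0) :
    QL ((π * I * y) ^ 2) = π * y * cos (π * y) / sin (π * y) := by
  have hs : sinh (π * I * y) = sin (π * y) * I := by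
    rw [← sinh_mul_I]; ring_nf
  have hc : cosh (π * I * y) = cos (π * y) := by
    rw [← cosh_mul_I]; ring_nf
  have h := QL_sq_mul_sinh (y := π * I * y) (by rw [hs]; exact mul_ne_zero hy I_ne_zero)
  rw [hs, hc] at h
  rw [eq_div_iff hy]
  refine mul_right_cancel₀ I_ne_zero ?_
  linear_combination h

/-- The formula `sin 2x = 2 sin x cos x`, with `QL((πiy)²) = πy cot πy`: the local source of the
duplication ratio. -/
lemma sincPi_two_mul {y : ℂ} (hy : sin (π * y) ≠ 0) :
    sincPi (2 * y) = sincPi y ^ 2 * QL ((π * I * y) ^ 2) := by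
  have hy0 : y ≠ 0 := by rintro rfl; simp at hy
  have hpi : (π : ℂ) ≠ 0 := by exact_mod_cast Real.pi_ne_zero
  rw [QL_sq_pi_mul_I hy, sincPi, sincPi, if_neg hy0, if_neg (mul_ne_zero two_ne_zero hy0),
    show π * (2 * y) = 2 * (π * y) by ring, sin_two_mul]
  field_simp

lemma heckeTerm_zero_mul (ω z : ℂ) :
    heckeTerm 0 ω * (π * I * z) ^ 2 = (π * I * (z / ω)) ^ 2 := by
  rw [heckeTerm_zero]
  ring

end LatticeProducts

/-! ### Passage to the limit and comparison with theta. -/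

section Limit

open Complex
open scoped Real

variable {τ : ℂ}

lemma norm_heckeTerm_le {s : ℝ} (hs : 0 ≤ s) {ω : ℂ} (hω : 1 ≤ ‖ω‖) :
    ‖heckeTerm s ω‖ ≤ (‖ω‖ ^ 2)⁻¹ := by
  have h0 : ω ≠ 0 := norm_pos_iff.mp (by linarith)
  rw [norm_heckeTerm s h0, ← Real.rpow_two, ← Real.rpow_neg (by linarith)]
  exact Real.rpow_le_rpow_of_exponent_le hω (by linarith)

lemma norm_heckeTerm_mul_le {s : ℝ} (hs : 0 ≤ s) {t ω : ℂ} (hω : 4 * ‖t‖ + 1 ≤ ‖ω‖) :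
    ‖heckeTerm s ω * t‖ ≤ 1 / 4 := by
  have ht := norm_nonneg t
  have h1 : 1 ≤ ‖ω‖ := by linarith
  rw [norm_mul]
  calc _ ≤ (‖ω‖ ^ 2)⁻¹ * ‖t‖ := by gcongr; exact norm_heckeTerm_le hs h1
    _ ≤ _ := by
      rw [← div_eq_inv_mul, div_le_iff₀ (by positivity)]
      nlinarith

lemma eventually_le_norm_primIndex (hτ : 0 < τ.im) (R : ℝ) :
    ∀ᶠ c : PrimIndex in cofinite, R ≤ ‖latticePt τ c‖ :=
  Subtype.val_injective.tendsto_cofinite.eventually (eventually_le_norm_latticePt hτ R)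

/-- The multiples `(k+1)ω` of a primitive `ω` contribute its term times `(k+1)^(-2-s)`, so the full
sum is `ζ(2+s)` times the primitive one. -/
lemma hasSum_heckeTerm_prim (hτ : 0 < τ.im) {s : ℝ} (hs : 0 < s) :
    HasSum (fun c : PrimIndex ↦ heckeTerm s (latticePt τ c))
      ((∑' p, heckeTerm s (latticePt τ p)) / ((∑' k : ℕ, 1 / ((k : ℝ) + 1) ^ (2 + s) : ℝ) : ℂ)) := by
  have hsum : Summable fun k : ℕ ↦ 1 / ((k : ℝ) + 1) ^ (2 + s) := by
    have := (summable_nat_add_iff 1).mpr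
      (Real.summable_one_div_nat_rpow.mpr (by linarith : 1 < 2 + s))
    simpa using this
  have hpos : 0 < ∑' k : ℕ, 1 / ((k : ℝ) + 1) ^ (2 + s) :=
    hsum.tsum_pos (fun k ↦ by positivity) 0 (by positivity)
  have h1 := (primEquiv.hasSum_iff.mpr (summable_heckeTerm hτ hs).hasSum).prod_fiberwise
    (g := fun c : PrimIndex ↦ ((∑' k : ℕ, 1 / ((k : ℝ) + 1) ^ (2 + s) : ℝ) : ℂ)
      * heckeTerm s (latticePt τ c)) fun c ↦ by
    refine ((Complex.hasSum_ofReal.mpr hsum.hasSum).mul_right _).congr_fun fun k ↦ ?_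
    have hk : 0 < (k : ℝ) + 1 := by positivity
    have hn : ‖(k : ℂ) + 1‖ = (k : ℝ) + 1 := by
      have : (k : ℂ) + 1 = (((k : ℝ) + 1 : ℝ) : ℂ) := by push_cast; rfl
      rw [this, Complex.norm_real, Real.norm_of_nonneg hk.le]
    simp only [Function.comp_apply, latticePt_primEquiv, heckeTerm]
    rw [norm_mul, hn, Real.mul_rpow hk.le (norm_nonneg _), Real.rpow_add hk, Real.rpow_two]
    push_cast
    rw [div_mul_div_comm, one_mul]
    congr 1
    ring
  refine (h1.div_const ((∑' k : ℕ, 1 / ((k : ℝ) + 1) ^ (2 + s) : ℝ) : ℂ)).congr_fun fun c ↦ ?_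
  rw [mul_div_cancel_left₀]
  exact_mod_cast hpos.ne'

lemma tendsto_tsum_one_div_add_one_rpow :
    Tendsto (fun s : ℝ ↦ ((∑' k : ℕ, 1 / ((k : ℝ) + 1) ^ (2 + s) : ℝ) : ℂ)) (𝓝[>] 0)
      (𝓝 ((π : ℂ) ^ 2 / 6)) := by
  have h2 : Summable fun k : ℕ ↦ 1 / ((k : ℝ) + 1) ^ 2 := by
    have := hasSum_one_div_add_one_sq.summable.norm
    refine this.congr fun k ↦ ?_
    have : (k : ℂ) + 1 = (((k : ℝ) + 1 : ℝ) : ℂ) := by push_cast; rfl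
    rw [this, norm_div, norm_one, norm_pow, Complex.norm_real, Real.norm_of_nonneg (by positivity)]
  have h := tendsto_tsum_of_dominated_convergence (𝓕 := 𝓝[>] (0 : ℝ))
    (f := fun (s : ℝ) (k : ℕ) ↦ 1 / ((k : ℝ) + 1) ^ (2 + s))
    (g := fun k : ℕ ↦ 1 / ((k : ℝ) + 1) ^ 2) h2 (fun k ↦ by
      have hk : 0 < (k : ℝ) + 1 := by positivity
      have hc : Continuous fun s : ℝ ↦ 1 / ((k : ℝ) + 1) ^ (2 + s) :=
        continuous_const.div (continuous_const.rpow (by fun_prop) fun _ ↦ Or.inl hk.ne')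
          fun s ↦ (Real.rpow_pos_of_pos hk _).ne'
      have := (hc.tendsto 0).mono_left (nhdsWithin_le_nhds (s := Set.Ioi 0))
      rwa [add_zero, Real.rpow_two] at this) (by
      filter_upwards [self_mem_nhdsWithin] with s hs k
      have hs' : (0 : ℝ) < s := hs
      rw [Real.norm_of_nonneg (by positivity), ← Real.rpow_two]
      gcongr
      · linarith [Nat.cast_nonneg (α := ℝ) k]
      · linarith)
  have h3 := (continuous_ofReal.tendsto _).comp h
  have e : ((∑' k : ℕ, 1 / ((k : ℝ) + 1) ^ 2 : ℝ) : ℂ) = (π : ℂ) ^ 2 / 6 := by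
    rw [← hasSum_one_div_add_one_sq.tsum_eq, ofReal_tsum]
    push_cast
    rfl
  rw [e] at h3
  exact h3

lemma tendsto_tsum_heckeTerm_prim (hτ : 0 < τ.im) :
    Tendsto (fun s ↦ ∑' c : PrimIndex, heckeTerm s (latticePt τ c)) (𝓝[>] 0)
      (𝓝 ((∑' p, heckeError τ 0 p - π / (2 * τ.im)) / (π ^ 2 / 6))) := by
  have hpi : (π : ℂ) ≠ 0 := by exact_mod_cast Real.pi_ne_zero
  refine ((tendsto_tsum_heckeTerm hτ).div tendsto_tsum_one_div_add_one_rpow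
    (div_ne_zero (pow_ne_zero 2 hpi) (by norm_num))).congr' ?_
  filter_upwards [self_mem_nhdsWithin] with s hs
  exact (hasSum_heckeTerm_prim hτ hs).tsum_eq.symm

lemma multipliable_QL_heckeTerm (hτ : 0 < τ.im) {s : ℝ} (hs : 0 < s) (t : ℂ) :
    Multipliable fun c : PrimIndex ↦ QL (heckeTerm s (latticePt τ c) * t) := by
  have h1 : Summable fun c : PrimIndex ↦ heckeTerm s (latticePt τ c) * t :=
    (hasSum_heckeTerm_prim hτ hs).summable.mul_right t
  have h2 : Summable fun c : PrimIndex ↦ QL (heckeTerm s (latticePt τ c) * t) - 1 :=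
    summable_of_isBigO' h1 (QL_sub_one_isBigO.comp_tendsto h1.tendsto_cofinite_zero)
  simpa using multipliable_one_add_of_summable h2.norm

lemma notMem_QLPoles_of_forall_ne {w : ℂ} (hw : ∀ k : ℤ, w ≠ k) : (π * I * w) ^ 2 ∉ QLPoles := by
  intro h
  have h1 := sinh_eq_zero_of_mem_QLPoles h rfl
  have h2 : sinh (π * I * w) = sin (π * w) * I := by
    rw [← sinh_mul_I]; ring_nf
  rw [h2] at h1
  refine sin_pi_mul_ne_zero_of_add_int_ne_zero (w := w) (fun n hn ↦ hw (-n) ?_)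
    ((mul_eq_zero.mp h1).resolve_right I_ne_zero)
  push_cast
  linear_combination hn

lemma div_latticePt_ne_intCast (hτ : 0 < τ.im) {z : ℂ} (hz : ∀ m n : ℤ, z ≠ m * τ + n)
    (p : ℕ × ℤ) (k : ℤ) : z / latticePt τ p ≠ k := by
  intro h
  rw [div_eq_iff (latticePt_ne_zero hτ p), latticePt] at h
  refine hz (k * (p.1 + 1)) (k * p.2) ?_
  push_cast
  linear_combination h

lemma sin_pi_mul_ne_zero_of_forall_ne {w : ℂ} (hw : ∀ k : ℤ, w ≠ k) : sin (π * w) ≠ 0 :=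
  sin_pi_mul_ne_zero_of_add_int_ne_zero fun n hn ↦ hw (-n) (by push_cast; linear_combination hn)

/-- The factors of the product over the primitive points, normalized by an exponential so that
the product converges at `s = 0` too. -/
noncomputable def normalizedFactor (τ t : ℂ) (s : ℝ) (c : PrimIndex) : ℂ :=
  QL (heckeTerm s (latticePt τ c) * t) * exp (-(heckeTerm s (latticePt τ c) * t) / 3)

/-- Distant points obey the quadratic bound uniformly in `s`; the finitely many others are
controlled by continuity at `s = 0`, where no factor has a pole. -/
lemma exists_normalizedFactor_bound (hτ : 0 < τ.im) {t : ℂ}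
    (ht : ∀ c : PrimIndex, heckeTerm 0 (latticePt τ c) * t ∉ QLPoles) :
    (∀ c, Tendsto (fun s ↦ normalizedFactor τ t s c - 1) (𝓝[>] 0)
      (𝓝 (normalizedFactor τ t 0 c - 1))) ∧
    ∃ bound : PrimIndex → ℝ, Summable bound ∧
      ∀ᶠ s in 𝓝[>] 0, ∀ c, ‖normalizedFactor τ t s c - 1‖ ≤ bound c := by
  have hcont : ∀ c, Tendsto (fun s ↦ normalizedFactor τ t s c - 1) (𝓝[>] 0)
      (𝓝 (normalizedFactor τ t 0 c - 1)) := by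
    intro c
    have h1 : Continuous fun s ↦ heckeTerm s (latticePt τ c) * t :=
      (continuous_heckeTerm (latticePt_ne_zero hτ c)).mul_const t
    have h2 : ContinuousAt (fun s ↦ QL (heckeTerm s (latticePt τ c) * t)) 0 :=
      ContinuousAt.comp (g := QL) (continuousAt_QL (ht c)) h1.continuousAt
    have h3 : Continuous fun s ↦ exp (-(heckeTerm s (latticePt τ c) * t) / 3) :=
      continuous_exp.comp (h1.neg.div_const 3)
    exact ((h2.mul h3.continuousAt).sub continuousAt_const).tendsto.mono_left nhdsWithin_le_nhds
  refine ⟨hcont, ?_⟩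
  -- Beyond norm `4‖t‖ + 1` the argument of `QL` has norm at most `1/4`, where the quadratic bound
  -- applies.
  set bad : Set PrimIndex := {c | ¬ 4 * ‖t‖ + 1 ≤ ‖latticePt τ c‖}
  have hfin : bad.Finite := eventually_le_norm_primIndex hτ (4 * ‖t‖ + 1)
  refine ⟨fun c ↦ 14 * ‖t‖ ^ 2 * (‖latticePt τ c‖ ^ 4)⁻¹
    + bad.indicator (fun c ↦ ‖normalizedFactor τ t 0 c - 1‖ + 1) c, ?_, ?_⟩
  · refine Summable.add (Summable.mul_left _
      ((summable_norm_latticePt_inv_pow_four hτ).comp_injective Subtype.val_injective)) ?_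
    exact summable_of_hasFiniteSupport (hfin.subset Set.support_indicator_subset)
  · have h1 : ∀ᶠ s in 𝓝[>] (0 : ℝ), ∀ c ∈ bad,
        ‖normalizedFactor τ t s c - 1‖ < ‖normalizedFactor τ t 0 c - 1‖ + 1 :=
      hfin.eventually_all.mpr fun c _ ↦ (hcont c).norm.eventually_lt_const (lt_add_one _)
    filter_upwards [h1, self_mem_nhdsWithin] with s hs hs0 c
    by_cases hc : c ∈ bad
    · rw [Set.indicator_of_mem hc]
      have := hs c hc
      have h0 : 0 ≤ 14 * ‖t‖ ^ 2 * (‖latticePt τ c‖ ^ 4)⁻¹ := by positivity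
      linarith
    · rw [Set.indicator_of_notMem hc, add_zero]
      have hc' : 4 * ‖t‖ + 1 ≤ ‖latticePt τ c‖ := not_not.mp hc
      have hs' : (0 : ℝ) ≤ s := le_of_lt hs0
      refine (norm_QL_mul_exp_sub_one_le (norm_heckeTerm_mul_le hs' hc')).trans ?_
      have h4 := norm_heckeTerm_le hs' (ω := latticePt τ c) (by linarith [norm_nonneg t])
      rw [norm_mul, mul_pow]
      calc _ ≤ 14 * (((‖latticePt τ c‖ ^ 2)⁻¹) ^ 2 * ‖t‖ ^ 2) := by gcongr
        _ = _ := by rw [inv_pow, ← pow_mul]; ring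

/-- For `s > 0` the exponential normalization can be summed separately. Its limit is Hecke's; the
normalized product converges by domination. -/
lemma tendsto_tprod_QL (hτ : 0 < τ.im) {t : ℂ}
    (ht : ∀ c : PrimIndex, heckeTerm 0 (latticePt τ c) * t ∉ QLPoles) :
    Tendsto (fun s ↦ ∏' c : PrimIndex, QL (heckeTerm s (latticePt τ c) * t)) (𝓝[>] 0)
      (𝓝 (exp (t / 3 * ((∑' p, heckeError τ 0 p - π / (2 * τ.im)) / (π ^ 2 / 6)))
        * ∏' c, normalizedFactor τ t 0 c)) := by
  obtain ⟨hcont, bound, hsum, hb⟩ := exists_normalizedFactor_bound hτ ht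
  have h1 := tendsto_tprod_one_add_of_dominated_convergence hsum hcont hb
  simp only [add_sub_cancel] at h1
  have h2 := (continuous_exp.tendsto _).comp ((tendsto_tsum_heckeTerm_prim hτ).const_mul (t / 3))
  refine (h2.mul h1).congr' ?_
  filter_upwards [hb, self_mem_nhdsWithin] with s hs hs0
  have hm : HasProd (normalizedFactor τ t s) (∏' c, normalizedFactor τ t s c) := by
    have := multipliable_one_add_of_summable (f := fun c ↦ normalizedFactor τ t s c - 1)
      (hsum.of_nonneg_of_le (fun _ ↦ norm_nonneg _) hs)
    simp only [add_sub_cancel] at this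
    exact this.hasProd
  have he := ((hasSum_heckeTerm_prim hτ hs0).summable.hasSum.mul_left (t / 3)).cexp
  refine ((he.mul hm).congr_fun fun c ↦ ?_).tprod_eq.symm
  simp only [Function.comp_apply, normalizedFactor]
  rw [mul_left_comm, ← exp_add]
  ring_nf
  simp

lemma hasProd_normalizedFactor_zero (hτ : 0 < τ.im) {t : ℂ}
    (ht : ∀ c : PrimIndex, heckeTerm 0 (latticePt τ c) * t ∉ QLPoles) :
    HasProd (normalizedFactor τ t 0) (∏' c, normalizedFactor τ t 0 c) := by
  obtain ⟨hcont, bound, hsum, hb⟩ := exists_normalizedFactor_bound hτ ht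
  have h : ∀ c, ‖normalizedFactor τ t 0 c - 1‖ ≤ bound c := fun c ↦
    le_of_tendsto (hcont c).norm (hb.mono fun s hs ↦ hs c)
  have := multipliable_one_add_of_summable (f := fun c ↦ normalizedFactor τ t 0 c - 1)
    (hsum.of_nonneg_of_le (fun _ ↦ norm_nonneg _) h)
  simp only [add_sub_cancel] at this
  exact this.hasProd

lemma heckeTerm_zero_mul_notMem_QLPoles (hτ : 0 < τ.im) {z : ℂ}
    (hz : ∀ m n : ℤ, z ≠ m * τ + n) (p : ℕ × ℤ) :
    heckeTerm 0 (latticePt τ p) * (π * I * z) ^ 2 ∉ QLPoles := by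
  rw [heckeTerm_zero_mul]
  exact notMem_QLPoles_of_forall_ne (div_latticePt_ne_intCast hτ hz p)

/-- The duplication formula for the Weierstrass product. -/
lemma weierstrass_two_mul (hτ : 0 < τ.im) {z : ℂ} (hz : ∀ m n : ℤ, z ≠ m * τ + n) :
    thetaProd (2 * z) τ * exp ((2 * z) ^ 2 * ∑' p, heckeError τ 0 p)
      = (thetaProd z τ * exp (z ^ 2 * ∑' p, heckeError τ 0 p)) ^ 2
        * ∏' c, normalizedFactor τ ((π * I * z) ^ 2) 0 c := by
  have h1 := hasProd_weierstrass_prim hτ z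
  have h2 := (h1.mul h1).mul (hasProd_normalizedFactor_zero hτ fun c ↦
    heckeTerm_zero_mul_notMem_QLPoles hτ hz c)
  rw [sq (thetaProd z τ * _)]
  refine ((h2.congr_fun fun c ↦ ?_).unique (hasProd_weierstrass_prim hτ (2 * z))).symm
  have hsin := sin_pi_mul_ne_zero_of_forall_ne (div_latticePt_ne_intCast hτ hz c)
  rw [normalizedFactor, heckeTerm_zero_mul, mul_div_assoc, sincPi_two_mul hsin]
  -- Of the four copies of the exponent created by doubling, two go to the square and the other two
  -- are `-w/3` for `w = (πiz/ω)²`, the normalization of `QL`.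
  have e : exp ((2 * z) ^ 2 / latticePt τ c ^ 2 * (π ^ 2 / 6))
      = exp (z ^ 2 / latticePt τ c ^ 2 * (π ^ 2 / 6))
        * exp (z ^ 2 / latticePt τ c ^ 2 * (π ^ 2 / 6))
        * exp (-(π * I * (z / latticePt τ c)) ^ 2 / 3) := by
    rw [← exp_add, ← exp_add]
    congr 1
    linear_combination (π ^ 2 * z ^ 2 / latticePt τ c ^ 2 / 3) * I_sq
  rw [e]
  ring

/-- The sines give `πz cot πz`, the factor of the primitive point `1`, and the Gaussian exponents
combine as `4 - 2 = 2` times `πz²/(2 Im τ)`. -/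
lemma theta_ratio_eq (hτ : 0 < τ.im) {z : ℂ} (hz : sin (π * z) ≠ 0) :
    π * I * z * (thetaTilde (2 * z) τ / thetaTilde z τ ^ 2)
      = QL ((π * I * z) ^ 2) * (exp (π * z ^ 2 / τ.im) * (thetaProd (2 * z) τ
        / thetaProd z τ ^ 2)) := by
  rw [thetaTilde_eq hτ, thetaTilde_eq hτ, QL_sq_pi_mul_I hz,
    show π * (2 * z) = 2 * (π * z) by ring, sin_two_mul]
  have e : exp (π / 2 * ((2 * z) ^ 2 / τ.im))
      = exp (π / 2 * (z ^ 2 / τ.im)) ^ 2 * exp (π * z ^ 2 / τ.im) := by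
    rw [← exp_nat_mul, ← exp_add]
    congr 1
    push_cast
    ring
  have h0 := exp_ne_zero (π / 2 * (z ^ 2 / τ.im))
  have hI := I_ne_zero
  rw [e]
  by_cases hp : thetaProd z τ = 0
  · simp [hp]
  · field_simp

lemma hasProd_LGenus (hτ : 0 < τ.im) {s : ℝ} (hs : 0 < s) (t : ℂ) :
    HasProd (fun x : Xset τ s ↦ QL ((x : ℂ) * t))
      ((∏' c : PrimIndex, QL (heckeTerm s (latticePt τ c) * t)) * QL t) := by
  have h := hasProd_Xset hτ hs.le (f := fun x ↦ QL (x * t)) (multipliable_QL_heckeTerm hτ hs t).hasProd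
  rwa [one_mul] at h

/-- Distant points give arguments of norm at most `1/4 < 9`; for the finitely many others, avoiding
the poles is an open condition that holds at `s = 0`. -/
lemma eventually_forall_notMem_QLPoles (hτ : 0 < τ.im) {t : ℂ} (h1 : t ∉ QLPoles)
    (ht : ∀ c : PrimIndex, heckeTerm 0 (latticePt τ c) * t ∉ QLPoles) :
    ∀ᶠ s : ℝ in 𝓝[>] 0, ∀ x ∈ Xset τ s, x * t ∉ QLPoles := by
  have hfin : {c : PrimIndex | ¬ 4 * ‖t‖ + 1 ≤ ‖latticePt τ c‖}.Finite :=
    eventually_le_norm_primIndex hτ (4 * ‖t‖ + 1)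
  have h2 : ∀ᶠ s in 𝓝[>] (0 : ℝ), ∀ c ∈ {c : PrimIndex | ¬ 4 * ‖t‖ + 1 ≤ ‖latticePt τ c‖},
      heckeTerm s (latticePt τ c) * t ∉ QLPoles := by
    refine hfin.eventually_all.mpr fun c _ ↦ ?_
    have hc : Continuous fun s ↦ heckeTerm s (latticePt τ c) * t :=
      (continuous_heckeTerm (latticePt_ne_zero hτ c)).mul_const t
    exact ((hc.tendsto 0).mono_left nhdsWithin_le_nhds).eventually
      (eventually_notMem_QLPoles (ht c))
  filter_upwards [h2, self_mem_nhdsWithin] with s hs hs0 x hx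
  rw [← range_heckeTerm_primPt] at hx
  obtain ⟨c | _, rfl⟩ := hx
  · by_cases hc : 4 * ‖t‖ + 1 ≤ ‖latticePt τ c‖
    · intro hp
      have h3 := nine_le_norm_of_mem_QLPoles hp
      have h4 := norm_heckeTerm_mul_le (le_of_lt hs0) hc
      simp only [primPt, Sum.elim_inl] at h3
      linarith
    · exact hs c hc
  · simpa [primPt, heckeTerm] using h1

lemma tendsto_LGenus (hτ : 0 < τ.im) {z : ℂ} (hz : ∀ m n : ℤ, z ≠ m * τ + n) :
    Tendsto (fun s : ℝ ↦ LGenus (Xset τ s) ((π * I * z) ^ 2)) (𝓝[>] 0)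
      (𝓝 (π * I * z * (thetaTilde (2 * z) τ / thetaTilde z τ ^ 2))) := by
  have hz0 : ∀ k : ℤ, z ≠ k := fun k h ↦ hz 0 k (by simpa using h)
  have h0 := thetaProd_ne_zero hτ hz
  have hpi : (π : ℂ) ≠ 0 := by exact_mod_cast Real.pi_ne_zero
  have hb : (τ.im : ℂ) ≠ 0 := by exact_mod_cast hτ.ne'
  have h1 := (tendsto_tprod_QL hτ fun c ↦ heckeTerm_zero_mul_notMem_QLPoles hτ hz c).mul_const
    (QL ((π * I * z) ^ 2))
  have e : exp ((π * I * z) ^ 2 / 3 * ((∑' p, heckeError τ 0 p - π / (2 * τ.im)) / (π ^ 2 / 6)))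
      * (∏' c, normalizedFactor τ ((π * I * z) ^ 2) 0 c)
      = exp (π * z ^ 2 / τ.im) * (thetaProd (2 * z) τ / thetaProd z τ ^ 2) := by
    have hW := weierstrass_two_mul hτ hz
    set G := ∑' p, heckeError τ 0 p
    -- Here `(t/3)·(6/π²) = -2z²`: the part with `G` will cancel against the duplication formula,
    -- and the Hecke correction becomes `exp (πz²/Im τ)`.
    have e1 : exp ((π * I * z) ^ 2 / 3 * ((G - π / (2 * τ.im)) / (π ^ 2 / 6)))
        = exp (π * z ^ 2 / τ.im) * (exp (z ^ 2 * G) ^ 2)⁻¹ := by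
      rw [← exp_nat_mul, ← exp_neg, ← exp_add]
      congr 1
      rw [mul_pow, mul_pow, I_sq]
      push_cast
      field_simp
      ring
    have e2 : exp ((2 * z) ^ 2 * G) = exp (z ^ 2 * G) ^ 2 * exp (z ^ 2 * G) ^ 2 := by
      rw [← exp_nat_mul, ← exp_add]
      congr 1
      push_cast
      ring
    have hE := exp_ne_zero (z ^ 2 * G)
    have hV : (∏' c, normalizedFactor τ ((π * I * z) ^ 2) 0 c)
        = thetaProd (2 * z) τ / thetaProd z τ ^ 2 * exp (z ^ 2 * G) ^ 2 := by
      rw [div_mul_eq_mul_div, eq_div_iff (pow_ne_zero 2 h0)]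
      refine mul_left_cancel₀ (pow_ne_zero 2 hE) ?_
      rw [e2] at hW
      linear_combination -hW
    rw [e1, hV]
    field_simp
  rw [e] at h1
  rw [theta_ratio_eq hτ (sin_pi_mul_ne_zero_of_forall_ne hz0),
    mul_comm (QL _)]
  refine h1.congr' ?_
  filter_upwards [self_mem_nhdsWithin] with s hs
  exact (hasProd_LGenus hτ hs _).tprod_eq.symm

lemma thetaTilde_ne_zero (hτ : 0 < τ.im) {z : ℂ} (hz : ∀ m n : ℤ, z ≠ m * τ + n) :
    thetaTilde z τ ≠ 0 := by
  have hz0 : ∀ k : ℤ, z ≠ k := fun k h ↦ hz 0 k (by simpa using h)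
  rw [thetaTilde_eq hτ]
  exact mul_ne_zero (mul_ne_zero (exp_ne_zero _) (mul_ne_zero (mul_ne_zero two_ne_zero I_ne_zero)
    (sin_pi_mul_ne_zero_of_forall_ne hz0))) (thetaProd_ne_zero hτ hz)

lemma tendsto_theta_ratio (hτ : 0 < τ.im) :
    Tendsto (fun z : ℂ ↦ π * I * z * (thetaTilde (2 * z) τ / thetaTilde z τ ^ 2)) (𝓝[≠] 0)
      (𝓝 1) := by
  have hP := continuous_thetaProd hτ
  have hpole : (π * I * (0 : ℂ)) ^ 2 ∉ QLPoles := fun h ↦ by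
    have := nine_le_norm_of_mem_QLPoles h
    norm_num at this
  have h1 : ContinuousAt (fun z : ℂ ↦ QL ((π * I * z) ^ 2)) 0 :=
    ContinuousAt.comp (g := QL) (continuousAt_QL hpole) (Continuous.continuousAt (by fun_prop))
  have h2 : Continuous fun z : ℂ ↦ exp (π * z ^ 2 / τ.im) := by fun_prop
  have h3 : ContinuousAt (fun z ↦ thetaProd (2 * z) τ / thetaProd z τ ^ 2) 0 :=
    (hP.comp (continuous_const.mul continuous_id)).continuousAt.div (hP.pow 2).continuousAt
      (by simp [thetaProd_zero hτ])
  have h4 := (h1.mul (h2.continuousAt.mul h3)).tendsto.mono_left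
    (nhdsWithin_le_nhds (s := {(0 : ℂ)}ᶜ))
  simp only [Pi.mul_apply, mul_zero, ne_eq, OfNat.ofNat_ne_zero, not_false_eq_true, zero_pow,
    zero_div, exp_zero, thetaProd_zero hτ, one_pow, div_one, mul_one] at h4
  rw [show QL 0 = 1 by simp [QL]] at h4
  refine h4.congr' ?_
  -- In the punctured unit disc there are no integers, so `sin πz` does not vanish.
  filter_upwards [self_mem_nhdsWithin, nhdsWithin_le_nhds (Metric.ball_mem_nhds (0 : ℂ) one_pos)]
    with z hz hz1
  refine (theta_ratio_eq hτ (sin_pi_mul_ne_zero_of_forall_ne fun k hk ↦ ?_)).symm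
  rw [hk, mem_ball_zero_iff, Complex.norm_intCast] at hz1
  have hk0 : k = 0 := Int.abs_lt_one_iff.mp (by exact_mod_cast hz1)
  exact hz (by simp [hk, hk0])

end Limit

theorem theorem1p2 (τ : ℂ) (hτ : 0 < τ.im) :
    (∀ z : ℂ, ∀ s : ℝ, 0 < s →
      (∀ x ∈ Xset τ s, x * ((Real.pi : ℂ) * Complex.I * z) ^ 2 ∉ QLPoles) →
      Multipliable (fun x : Xset τ s => QL ((x : ℂ) * ((Real.pi : ℂ) * Complex.I * z) ^ 2))) ∧
    (∀ z : ℂ, (∀ m n : ℤ, z ≠ (m : ℂ) * τ + n) →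
      (∀ᶠ s : ℝ in 𝓝[>] 0,
        ∀ x ∈ Xset τ s, x * ((Real.pi : ℂ) * Complex.I * z) ^ 2 ∉ QLPoles) ∧
      thetaTilde z τ ≠ 0 ∧
      Tendsto (fun s : ℝ => LGenus (Xset τ s) (((Real.pi : ℂ) * Complex.I * z) ^ 2)) (𝓝[>] 0)
        (𝓝 ((Real.pi : ℂ) * Complex.I * z * (thetaTilde (2 * z) τ / thetaTilde z τ ^ 2)))) ∧
    (Tendsto (fun s : ℝ => LGenus (Xset τ s) (((Real.pi : ℂ) * Complex.I * 0) ^ 2)) (𝓝[>] 0)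
        (𝓝 1) ∧
      Tendsto (fun z : ℂ =>
          (Real.pi : ℂ) * Complex.I * z * (thetaTilde (2 * z) τ / thetaTilde z τ ^ 2))
        (𝓝[≠] 0) (𝓝 1)) := by
  refine ⟨fun z s hs _ ↦ (hasProd_LGenus hτ hs _).multipliable, fun z hz ↦
    ⟨?_, thetaTilde_ne_zero hτ hz, tendsto_LGenus hτ hz⟩, ?_, tendsto_theta_ratio hτ⟩
  · exact eventually_forall_notMem_QLPoles hτ
      (notMem_QLPoles_of_forall_ne fun k h ↦ hz 0 k (by simpa using h))
      fun c ↦ heckeTerm_zero_mul_notMem_QLPoles hτ hz c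
  -- At `z = 0` every factor is `QL 0 = 1`.
  · simp [LGenus, QL]
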